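/- Let $M$ be a smooth supermanifold of dimension $p|q$ with local coordinates $x^a$ of parity $\tilde a$. Let $\Pi TM$ and $\Pi T^*M$ be its tangent and cotangent bundles with reversed parity, with induced fibre coordinates $dx^a$ and $x^*_a$ of parity $\tilde a+1$. Forms on $M$ are by definition the smooth functions on $\Pi TM$, with exterior differential $d=dx^a\,\partial/\partial x^a$. Multivector fields are the smooth functions on $\Pi T^*M$, with the canonical Schouten bracket $$[P,Q]=\frac{P\overleftarrow{\partial}}{\partial x^*_a}\,\frac{\overrightarrow{\partial}Q}{\partial x^a}-\frac{P\overleftarrow{\partial}}{\partial x^a}\,\frac{\overrightarrow{\partial}Q}{\partial x^*_a},$$ so that for even $P$ one has $[P,P]=2\sum_a(-1)^{\tilde a+1}\frac{\partial P}{\partial x^*_a}\frac{\partial P}{\partial x^a}$ (derivatives without an arrow are left derivatives). Let $P$ be an even multivector field on $M$ and let $\varphi_P\colon \Pi T^*M\to\Pi TM$ be the map over $M$ given by $\varphi_P^*(dx^a)=(-1)^{\tilde a+1}\,\partial P/\partial x^*_a$. Assume that $\varphi_P$ is invertible or, more generally, that it restricts to an isomorphism of supermanifolds $\varphi_P\colon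 W\to V$ between open subsets $W\subseteq\Pi T^*M$ and $V\subseteq\Pi TM$ (the case $W=\Pi T^*M$, $V=\Pi TM$ is the invertibility of $\varphi_P$). Let $$\omega=(\varphi_P^*)^{-1}\Bigl(x^*_a\frac{\partial P}{\partial x^*_a}-P\Bigr)$$ be the fibrewise Legendre transform of $P$. Then $\omega$ is a well-defined even form (a smooth even function on $V$), and $$d\omega=-\tfrac12\,(\varphi_P^*)^{-1}\bigl([P,P]\bigr)\quad\text{on } V.$$ Consequently $[P,P]=0$ on $W$ if and only if $d\omega=0$ on $V$. -/

import Mathlib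

open scoped ContDiff

/-! ### Grassmann algebras -/

/-- The real Grassmann algebra on odd generators `θ_b`, `b : β`. The family `g` stands for
`∑_I g I • θ_I`, where `θ_I` is the product of the `θ_b`, `b ∈ I`, in increasing order. -/
def Grassmann (β : Type*) : Type _ := Finset β → ℝ

namespace Grassmann

variable {β : Type*}

noncomputable instance [Fintype β] : NormedAddCommGroup (Grassmann β) :=
  inferInstanceAs (NormedAddCommGroup (Finset β → ℝ))

noncomputable instance [Fintype β] : NormedSpace ℝ (Grassmann β) :=
  inferInstanceAs (NormedSpace ℝ (Finset β → ℝ))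

instance [DecidableEq β] : One (Grassmann β) := ⟨fun I => if I = ∅ then 1 else 0⟩

/-- The generator `θ_b`. -/
def gen [DecidableEq β] (b : β) : Grassmann β := fun I => if I = {b} then 1 else 0

/-- `θ_I θ_J = sign I J • θ_(I ∪ J)` for disjoint `I`, `J`. -/
def sign [LinearOrder β] (I J : Finset β) : ℝ :=
  (-1) ^ ((I ×ˢ J).filter fun c => c.2 < c.1).card

instance [LinearOrder β] : Mul (Grassmann β) :=
  ⟨fun f g K => ∑ I ∈ K.powerset, sign I (K \ I) * f I * g (K \ I)⟩

/-- The left derivative with respect to `θ_b`. -/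
def leftDeriv [LinearOrder β] (b : β) (f : Grassmann β) : Grassmann β := fun K =>
  if b ∈ K then 0 else (-1) ^ (K.filter fun k => k < b).card * f (insert b K)

/-- The parity involution: `+1` on even elements, `-1` on odd ones. -/
def involution (f : Grassmann β) : Grassmann β := fun I => (-1) ^ I.card * f I

/-- The coefficient of `1`. -/
def body (f : Grassmann β) : ℝ := f ∅

/-- The nilpotent part of an element. -/
noncomputable def soul [Fintype β] [DecidableEq β] (f : Grassmann β) : Grassmann β :=
  f - f.body • (1 : Grassmann β)

/-- `f` is homogeneous of parity `s` (`0` is even, `1` is odd). -/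
def HasParity (s : ZMod 2) (f : Grassmann β) : Prop := ∀ I, f I ≠ 0 → (I.card : ZMod 2) = s

end Grassmann

/-! ### Superdomains

A superdomain has even coordinates indexed by `α` and odd coordinates indexed by `β`, and
`α ⊕ β` indexes all of them. Its body is an open subset of `α → ℝ`. -/

/-- Functions of the even coordinates `α` and the odd coordinates `β`. -/
abbrev SFun (α β : Type*) : Type _ := (α → ℝ) → Grassmann β

/-- A tuple of functions of `α | β`, one for each of the coordinates `α' | β'`: what a map
of superdomains is given by. -/
abbrev STuple (α' β' α β : Type*) : Type _ := α' ⊕ β' → SFun α β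

/-- The parity of a coordinate. -/
def coordParity {α β : Type*} : α ⊕ β → ZMod 2
  | .inl _ => 0
  | .inr _ => 1

/-- The sign `(-1) ^ ã`, where `ã` is the parity of the coordinate `a`. -/
def paritySign {α β : Type*} : α ⊕ β → ℝ
  | .inl _ => 1
  | .inr _ => -1

namespace SFun

variable {α β α' β' : Type*}
variable [Fintype α] [DecidableEq α] [Fintype β] [LinearOrder β]

/-- The coordinate functions. -/
noncomputable def coord : α ⊕ β → SFun α β
  | .inl a => fun x => x a • (1 : Grassmann β)
  | .inr b => fun _ => Grassmann.gen b

/-- Left partial derivatives with respect to the coordinates. -/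
noncomputable def pd : α ⊕ β → SFun α β → SFun α β
  | .inl a => fun f x => fderiv ℝ f x (Pi.single a 1)
  | .inr b => fun f x => (f x).leftDeriv b

/-- Right partial derivatives: on `f` of parity `s` they are `(-1) ^ (c̃ (s + 1))` times the
left ones, `c̃` being the parity of the coordinate `c`. -/
noncomputable def rpd : α ⊕ β → SFun α β → SFun α β
  | .inl a => fun f => pd (.inl a) f
  | .inr b => fun f => -pd (.inr b) (fun x => (f x).involution)

/-- The product of the odd elements `η_j`, `j ∈ J`, in increasing order. -/
def oddProd [LinearOrder β'] (η : β' → Grassmann β) (J : Finset β') : Grassmann β :=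
  ((J.sort (· ≤ ·)).map η).prod

/-- The operator `∑ₐ νₐ ∂/∂yᵃ` on Grassmann-valued functions of `y : α' → ℝ`. -/
noncomputable def shiftOp [Fintype α'] [DecidableEq α'] (ν : α' → Grassmann β)
    (g : (α' → ℝ) → Grassmann β) : (α' → ℝ) → Grassmann β :=
  fun y => ∑ a, ν a * fderiv ℝ g y (Pi.single a 1)

/-- The map of bodies underlying `Φ`. -/
def bodyMap (Φ : STuple α' β' α β) (x : α → ℝ) : α' → ℝ := fun a => (Φ (.inl a) x).body

/-- The pull-back `f ∘ Φ`: the odd coordinates of `f` are replaced by the odd components of `Φ`,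
and the even ones by the even components through the Taylor expansion at the body, which is
finite because the souls are nilpotent. -/
noncomputable def pull [Fintype α'] [DecidableEq α'] [Fintype β'] [LinearOrder β']
    (f : SFun α' β') (Φ : STuple α' β' α β) : SFun α β := fun x =>
  ∑ k ∈ Finset.range (Fintype.card β + 1), ((k.factorial : ℝ)⁻¹) •
    ((shiftOp fun a => (Φ (.inl a) x).soul)^[k]
      fun y => ∑ J, (f y J) • oddProd (fun b => Φ (.inr b) x) J) (bodyMap Φ x)

/-- `f` is homogeneous of parity `s` over `U`. -/
def HasParityOn (s : ZMod 2) (f : SFun α β) (U : Set (α → ℝ)) : Prop :=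
  ∀ x ∈ U, (f x).HasParity s

/-- `Φ` is a map of superdomains from the one over `U` to the one over `V`. -/
structure IsMapOn (Φ : STuple α' β' α β) (U : Set (α → ℝ)) (V : Set (α' → ℝ)) : Prop where
  smooth : ∀ c, ContDiffOn ℝ ∞ (Φ c) U
  parity : ∀ c, HasParityOn (coordParity c) (Φ c) U
  mapsTo : Set.MapsTo (bodyMap Φ) U V

/-- `Φ : U → V` and `Ψ : V → U` are mutually inverse maps of superdomains. -/
structure IsInverseOn [Fintype α'] [DecidableEq α'] [Fintype β'] [LinearOrder β']
    (Φ : STuple α' β' α β) (Ψ : STuple α β α' β') (U : Set (α → ℝ)) (V : Set (α' → ℝ)) :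
    Prop where
  map : IsMapOn Φ U V
  inv : IsMapOn Ψ V U
  right_inv : ∀ c, Set.EqOn (pull (Φ c) Ψ) (coord c) V
  left_inv : ∀ c, Set.EqOn (pull (Ψ c) Φ) (coord c) U

end SFun

open SFun

/-! ### Supermanifolds -/

/-- The structure of a smooth supermanifold of dimension `p | q` on a topological space `M`,
its body. The transition `trans i j` expresses the coordinates of the `j`-th chart through those
of the `i`-th over the intersection of the two; its values elsewhere are irrelevant. -/
structure SuperAtlas (p q : ℕ) (M : Type*) [TopologicalSpace M] where
  Index : Type*
  chart : Index → OpenPartialHomeomorph M (Fin p → ℝ)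
  cover : ∀ m, ∃ i, m ∈ (chart i).source
  trans : Index → Index → STuple (Fin p) (Fin q) (Fin p) (Fin q)
  trans_smooth : ∀ i j c,
    ContDiffOn ℝ ∞ (trans i j c) ((chart i).symm.trans (chart j)).source
  trans_parity : ∀ i j c,
    HasParityOn (coordParity c) (trans i j c) ((chart i).symm.trans (chart j)).source
  trans_body : ∀ i j, Set.EqOn (bodyMap (trans i j)) ((chart i).symm.trans (chart j))
    ((chart i).symm.trans (chart j)).source
  trans_self : ∀ i c, Set.EqOn (trans i i c) (coord c) (chart i).target
  trans_comp : ∀ i j k c, Set.EqOn (pull (trans j k c) (trans i j)) (trans i k c)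
    (((chart i).symm.trans (chart j)).source ∩ ((chart i).symm.trans (chart k)).source)

/-! ### The bundles `ΠTM` and `ΠT*M` in charts

Over a chart with coordinates `xᵃ`, `a : Fin p ⊕ Fin q` (`p` even, `q` odd), both total spaces
have the coordinates `xᵃ` and fibre coordinates of the opposite parity: `dxᵃ` on `ΠTM` and `x*ₐ` on
`ΠT*M`. So there are `p + q` even coordinates (the even `xᵃ`, the fibre coordinates of the odd `xᵃ`)
and `q + p` odd ones (the odd `xᵃ`, the fibre coordinates of the even `xᵃ`). -/

/-- Functions on the total space over a chart. -/
abbrev TFun (p q : ℕ) : Type := SFun (Fin p ⊕ Fin q) (Fin q ⊕ₗ Fin p)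

/-- Indices of the coordinates of the total space. -/
abbrev TIdx (p q : ℕ) : Type := (Fin p ⊕ Fin q) ⊕ (Fin q ⊕ₗ Fin p)

/-- Tuples of functions on the total space indexed by its coordinates. -/
abbrev TTuple (p q : ℕ) : Type :=
  STuple (Fin p ⊕ Fin q) (Fin q ⊕ₗ Fin p) (Fin p ⊕ Fin q) (Fin q ⊕ₗ Fin p)

section Local

variable {p q : ℕ}

/-- The index of the coordinate `xᵃ` of the total space. -/
def baseIdx : Fin p ⊕ Fin q → TIdx p q
  | .inl i => .inl (.inl i)
  | .inr j => .inr (toLex (.inl j))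

/-- The index of the fibre coordinate (`dxᵃ` or `x*ₐ`) of the total space. -/
def fibIdx : Fin p ⊕ Fin q → TIdx p q
  | .inl i => .inr (toLex (.inr i))
  | .inr j => .inl (.inr j)

/-- The tuple with components `B a` at the coordinate `xᵃ` and `F a` at the fibre coordinate. -/
def tuple (B F : Fin p ⊕ Fin q → TFun p q) : TTuple p q
  | .inl (.inl i) => B (.inl i)
  | .inl (.inr j) => F (.inr j)
  | .inr l =>
    match ofLex l with
    | .inl j => B (.inr j)
    | .inr i => F (.inl i)

/-- A function of the base coordinates as a function on the total space. -/
noncomputable def lift (f : SFun (Fin p) (Fin q)) : TFun p q :=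
  pull f fun a => coord (baseIdx a)

/-- The coordinate expression of the map `φ_P : ΠT*M → ΠTM` over `M`,
`dxᵃ ↦ (-1) ^ (ã + 1) ∂P/∂x*ₐ`. -/
noncomputable def phi (P : TFun p q) : TTuple p q :=
  tuple (fun a => coord (baseIdx a)) (fun a => -paritySign a • pd (fibIdx a) P)

/-- `x*ₐ ∂P/∂x*ₐ - P`. -/
noncomputable def eulerSub (P : TFun p q) : TFun p q :=
  ∑ a, coord (fibIdx a) * pd (fibIdx a) P - P

/-- The exterior differential `d = dxᵃ ∂/∂xᵃ`. -/
noncomputable def extDiff (F : TFun p q) : TFun p q :=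
  ∑ a, coord (fibIdx a) * pd (baseIdx a) F

/-- The canonical Schouten bracket. It is the odd Poisson bracket with `[x*ₐ, xᵇ] = δₐᵇ`;
for a vector field `X = Xᵃ x*ₐ` and a function `f` on `M`, `[X, f] = X f`. -/
noncomputable def schouten (P Q : TFun p q) : TFun p q :=
  ∑ a, (rpd (fibIdx a) P * pd (baseIdx a) Q - rpd (baseIdx a) P * pd (fibIdx a) Q)

end Local

namespace SuperAtlas

variable {p q : ℕ} {M : Type*} [TopologicalSpace M] (A : SuperAtlas p q M)

/-- The body of the total space (of `ΠTM` or `ΠT*M`) over the `i`-th chart. -/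
def dom (i : A.Index) : Set (Fin p ⊕ Fin q → ℝ) :=
  {z | (fun k => z (.inl k)) ∈ (A.chart i).target}

/-- The part of it over the intersection with the `j`-th chart. -/
def overlap (i j : A.Index) : Set (Fin p ⊕ Fin q → ℝ) :=
  {z | (fun k => z (.inl k)) ∈ ((A.chart i).symm.trans (A.chart j)).source}

/-- The transitions of `ΠTM`: `dx'ᵇ = dxᵃ ∂x'ᵇ/∂xᵃ`, where `x'` are the coordinates of the `j`-th
chart and `x` those of the `i`-th. -/
noncomputable def tangentTrans (i j : A.Index) : TTuple p q :=
  tuple (fun b => lift (A.trans i j b))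
    (fun b => ∑ a, coord (fibIdx a) * lift (pd a (A.trans i j b)))

/-- The transitions of `ΠT*M`: `x*'_b = ∂xᵃ/∂x'ᵇ x*ₐ`, where `x'` are the coordinates of the `j`-th
chart and `x` those of the `i`-th. -/
noncomputable def cotangentTrans (i j : A.Index) : TTuple p q :=
  tuple (fun b => lift (A.trans i j b))
    (fun b => ∑ a, lift (pull (pd b (A.trans j i a)) (A.trans i j)) * coord (fibIdx a))

/-- The sets `W i` are the charts of an open subset `W` of the total space with transitions `T`. -/
structure IsOpenSub (T : A.Index → A.Index → TTuple p q)
    (W : A.Index → Set (Fin p ⊕ Fin q → ℝ)) : Prop where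
  isOpen : ∀ i, IsOpen (W i)
  subset : ∀ i, W i ⊆ A.dom i
  compat : ∀ i j, ∀ z ∈ A.overlap i j, (z ∈ W i ↔ bodyMap (T i j) z ∈ W j)

/-- The family `F` is the coordinate expression of a smooth function of parity `s` over the open
subset `W` of the total space with transitions `T`. -/
structure IsFunction (T : A.Index → A.Index → TTuple p q)
    (W : A.Index → Set (Fin p ⊕ Fin q → ℝ)) (s : ZMod 2) (F : A.Index → TFun p q) : Prop where
  smooth : ∀ i, ContDiffOn ℝ ∞ (F i) (W i)
  parity : ∀ i, HasParityOn s (F i) (W i)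
  compat : ∀ i j, Set.EqOn (F i) (pull (F j) (T i j)) (W i ∩ A.overlap i j)

/-- `P` is an even multivector field on `M`: an even function on `ΠT*M`. -/
def IsEvenMultivector (P : A.Index → TFun p q) : Prop :=
  A.IsFunction A.cotangentTrans A.dom 0 P

/-- `ψ` is the inverse of the restriction `φ_P : W → V`. As `φ_P` is a map over `M`, this is a
condition over each chart. -/
def IsInversePhi (P : A.Index → TFun p q) (W V : A.Index → Set (Fin p ⊕ Fin q → ℝ))
    (ψ : A.Index → TTuple p q) : Prop :=
  ∀ i, IsInverseOn (phi (P i)) (ψ i) (W i) (V i)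

/-- The fibrewise Legendre transform `(φ_P*)⁻¹ (x*ₐ ∂P/∂x*ₐ - P)` of `P`, where `ψ = φ_P⁻¹`. -/
noncomputable def legendre (P : A.Index → TFun p q) (ψ : A.Index → TTuple p q) :
    A.Index → TFun p q :=
  fun i => pull (eulerSub (P i)) (ψ i)

end SuperAtlas

/-! In a chart write `E = x*ₐ ∂P/∂x*ₐ - P` and `φ = φ_P`. As in the classical Legendre transform,
the product rule gives `dE = dx*ₐ ∂P/∂x*ₐ + x*ₐ d(∂P/∂x*ₐ) - dP`; the terms with `dx*ₐ` cancel. The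
Koszul sign from moving `x*ₐ` past the derivative of `∂P/∂x*ₐ` is exactly the sign in the definition
of `φ`. So every partial derivative of `E` is `∑ₑ ∂φᵉ · wₑ`, where `w` is `-∂P/∂xᵃ` in the base
directions and `x*ₐ` in the fibre directions (`pd_eulerSub`). Pulling back by `ψ = φ⁻¹` and using
the chain rule, the Jacobians of `φ` and `ψ` cancel, so `∂ω/∂xᵃ = -ψ*(∂P/∂xᵃ)` and `∂ω/∂dxᵃ = ψ*
x*ₐ` (`pd_pull_eulerSub`). Then `dω = dxᵃ ∂ω/∂xᵃ = ψ*(∑ₐ φ*(dxᵃ) (-∂P/∂xᵃ))`. The two halves of `[P,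
P]` coincide, which makes this sum `-½ [P, P]` (`schouten_self`). The equivalence follows because
`ψ*` is inverted by `φ*`.

This calculation needs `pull`, defined by a Taylor formula, to be a functorial algebra homomorphism
satisfying the chain rule. The chain rule is proved once, for an arbitrary point derivation
(`IsPointDerivation.pull`), and applied both to the partial derivatives and to the Euler operator `N
= ∑ θ_b ∂/∂θ_b`. The second case drives the other identities: for the defect `u(f)` of such an
identity, `N u(f)` is a sum of terms `N(Φᶜ) · u(g)`, with `g` a derivative of `f`. Since `N(Φᶜ)` has
no body and `N` is invertible on elements without body, the order of all defects climbs without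
bound, so they vanish (`eq_zero_of_eulerL`); only the bodies have to be compared by hand.

For the global statement, `E` is invariant under the transitions of `ΠT*M` because the fibre Euler
field is invariant under linear changes of fibre coordinates (`eulerSub_compat`). The maps `φ`
intertwine the transitions of the two bundles (`phi_compat`), hence so do their inverses, and the
local forms `ω` agree on overlaps (`legendre_compat`). -/

set_option linter.unusedSectionVars false

/-! ### Signs and the ring structure of a Grassmann algebra -/

namespace Grassmann

variable {β : Type*}

theorem ext' {f g : Grassmann β} (h : ∀ I, f I = g I) : f = g := funext h

theorem involution_apply (f : Grassmann β) (I : Finset β) :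
    f.involution I = (-1) ^ I.card * f I := rfl

section Module

variable [Fintype β]

theorem add_apply (f g : Grassmann β) (I : Finset β) : (f + g) I = f I + g I := rfl
theorem sub_apply (f g : Grassmann β) (I : Finset β) : (f - g) I = f I - g I := rfl
theorem neg_apply (f : Grassmann β) (I : Finset β) : (-f) I = -f I := rfl
theorem zero_apply (I : Finset β) : (0 : Grassmann β) I = 0 := rfl
theorem smul_apply (r : ℝ) (f : Grassmann β) (I : Finset β) : (r • f) I = r * f I := rfl

theorem sum_apply {ι : Type*} (s : Finset ι) (f : ι → Grassmann β) (I : Finset β) :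
    (∑ i ∈ s, f i) I = ∑ i ∈ s, f i I :=
  Finset.sum_apply I s (fun i => (f i : Finset β → ℝ))

instance : FiniteDimensional ℝ (Grassmann β) :=
  inferInstanceAs (FiniteDimensional ℝ (Finset β → ℝ))

end Module

section Sign

variable [LinearOrder β]

theorem sign_eq_prod (I J : Finset β) :
    sign I J = ∏ i ∈ I, ∏ j ∈ J, if j < i then (-1 : ℝ) else 1 := by
  rw [← Finset.prod_product', Finset.prod_ite, Finset.prod_const, Finset.prod_const_one, mul_one]
  rfl

theorem sign_union_left {I J : Finset β} (K : Finset β) (h : Disjoint I J) :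
    sign (I ∪ J) K = sign I K * sign J K := by
  simp only [sign_eq_prod, Finset.prod_union h]

theorem sign_union_right (I : Finset β) {J K : Finset β} (h : Disjoint J K) :
    sign I (J ∪ K) = sign I J * sign I K := by
  simp only [sign_eq_prod, Finset.prod_union h, Finset.prod_mul_distrib]

theorem sign_mul_self (I J : Finset β) : sign I J * sign I J = 1 := by
  rw [sign, ← mul_pow]; simp

/-- Each pair `(i, j)` in `I × J` has `i ≠ j`, so it is an inversion for exactly one of the two
orders; the product of the signs is one factor `-1` per pair. -/
theorem sign_swap {I J : Finset β} (h : Disjoint I J) :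
    sign I J = (-1) ^ (I.card * J.card) * sign J I := by
  have : sign I J * sign J I = (-1) ^ (I.card * J.card) := by
    rw [sign_eq_prod, sign_eq_prod, Finset.prod_comm (s := J), ← Finset.prod_mul_distrib,
      Finset.prod_congr rfl (g := fun _ => (-1 : ℝ) ^ J.card), Finset.prod_const, ← pow_mul,
      mul_comm]
    intro i hi
    rw [← Finset.prod_mul_distrib, Finset.prod_congr rfl (g := fun _ => (-1 : ℝ)),
      Finset.prod_const]
    intro j hj
    have hij : i ≠ j := fun e => Finset.disjoint_left.1 h hi (e ▸ hj)
    rcases lt_or_gt_of_ne hij with h | h <;> simp [h, h.not_gt]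
  rw [← this, mul_assoc, sign_mul_self, mul_one]

@[simp] theorem sign_empty_left (J : Finset β) : sign ∅ J = 1 := by simp [sign]
@[simp] theorem sign_empty_right (I : Finset β) : sign I ∅ = 1 := by simp [sign]

theorem sign_singleton_left (b : β) (K : Finset β) :
    sign {b} K = (-1) ^ (K.filter fun k => k < b).card := by
  rw [sign_eq_prod, Finset.prod_singleton, Finset.prod_ite, Finset.prod_const,
    Finset.prod_const_one, mul_one]

theorem mul_apply (f g : Grassmann β) (K : Finset β) :
    (f * g) K = ∑ I ∈ K.powerset, sign I (K \ I) * f I * g (K \ I) := rfl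

theorem one_apply (I : Finset β) : (1 : Grassmann β) I = if I = ∅ then 1 else 0 := rfl

theorem leftDeriv_apply (b : β) (f : Grassmann β) (K : Finset β) :
    f.leftDeriv b K = if b ∈ K then 0 else sign {b} K * f (insert b K) := by
  rw [sign_singleton_left]; rfl

end Sign

section Ring

variable [LinearOrder β]

/-- Both sides are sums over ordered partitions of `K` into three blocks. The signs agree because
`sign` is multiplicative over disjoint unions in each argument: both count the inversions between
the three pairs of blocks. -/
theorem mul_assoc' (f g h : Grassmann β) : f * g * h = f * (g * h) := by
  refine funext fun K => ?_
  simp only [mul_apply, Finset.mul_sum, Finset.sum_mul]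
  rw [Finset.sum_sigma', Finset.sum_sigma']
  refine Finset.sum_bij' (fun c _ => ⟨c.2, c.1 \ c.2⟩) (fun c _ => ⟨c.1 ∪ c.2, c.1⟩) ?_ ?_ ?_ ?_ ?_
  · rintro ⟨L, I⟩ h
    simp only [Finset.mem_sigma, Finset.mem_powerset] at h ⊢
    exact ⟨h.2.trans h.1, Finset.sdiff_subset_sdiff h.1 le_rfl⟩
  · rintro ⟨I, J⟩ h
    simp only [Finset.mem_sigma, Finset.mem_powerset] at h ⊢
    exact ⟨Finset.union_subset h.1 (h.2.trans Finset.sdiff_subset), Finset.subset_union_left⟩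
  · rintro ⟨L, I⟩ h
    simp only [Finset.mem_sigma, Finset.mem_powerset] at h
    simp [Finset.union_sdiff_of_subset h.2]
  · rintro ⟨I, J⟩ h
    simp only [Finset.mem_sigma, Finset.mem_powerset, Finset.subset_sdiff] at h
    simp [Finset.union_sdiff_cancel_left h.2.2.symm]
  · rintro ⟨L, I⟩ h
    simp only [Finset.mem_sigma, Finset.mem_powerset] at h
    obtain ⟨hL, hI⟩ := h
    have e1 : (K \ I) \ (L \ I) = K \ L := by
      ext x; simp only [Finset.mem_sdiff]
      have := @hI x; tauto
    have e2 : K \ I = (L \ I) ∪ (K \ L) := by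
      ext x; simp only [Finset.mem_sdiff, Finset.mem_union]
      have := @hI x; have := @hL x; tauto
    have d1 : Disjoint (L \ I) (K \ L) :=
      Finset.disjoint_of_subset_left Finset.sdiff_subset Finset.disjoint_sdiff
    have s1 : sign L (K \ L) = sign I (K \ L) * sign (L \ I) (K \ L) := by
      rw [← sign_union_left _ Finset.disjoint_sdiff, Finset.union_sdiff_of_subset hI]
    have s2 : sign I (K \ I) = sign I (L \ I) * sign I (K \ L) := by
      rw [← sign_union_right _ d1, ← e2]
    dsimp only
    rw [e1, s1, s2]
    ring

variable [Fintype β]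

noncomputable scoped instance : Ring (Grassmann β) :=
  { (inferInstance : AddCommGroup (Grassmann β)) with
    mul := (· * ·)
    one := 1
    left_distrib := fun f g h => ext' fun K => by
      simp only [mul_apply, add_apply, mul_add, Finset.sum_add_distrib]
    right_distrib := fun f g h => ext' fun K => by
      simp only [mul_apply, add_apply, mul_add, add_mul, Finset.sum_add_distrib]
    zero_mul := fun f => ext' fun K => by simp [mul_apply, zero_apply]
    mul_zero := fun f => ext' fun K => by simp [mul_apply, zero_apply]
    mul_assoc := mul_assoc'
    one_mul := fun f => ext' fun K => by
      rw [mul_apply, Finset.sum_eq_single ∅]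
      · simp [one_apply]
      · intro I _ h; simp [one_apply, h]
      · simp
    mul_one := fun f => ext' fun K => by
      rw [mul_apply, Finset.sum_eq_single K]
      · simp [one_apply]
      · intro I hI h
        have : K \ I ≠ ∅ := fun e => h
          ((Finset.mem_powerset.1 hI).antisymm (Finset.sdiff_eq_empty_iff_subset.1 e))
        simp [one_apply, this]
      · simp }

instance : IsScalarTower ℝ (Grassmann β) (Grassmann β) :=
  ⟨fun r f g => ext' fun K => by
    simp only [smul_eq_mul, mul_apply, smul_apply, Finset.mul_sum]
    exact Finset.sum_congr rfl fun _ _ => by ring⟩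

instance : SMulCommClass ℝ (Grassmann β) (Grassmann β) :=
  ⟨fun r f g => ext' fun K => by
    simp only [smul_eq_mul, mul_apply, smul_apply, Finset.mul_sum]
    exact Finset.sum_congr rfl fun _ _ => by ring⟩

end Ring

end Grassmann

/-! ### Parity, the Euler operator and left derivatives -/

namespace Grassmann

variable {β : Type*}

section Parity

theorem HasParity.eq_zero {s t : ZMod 2} {f : Grassmann β} (hf : f.HasParity s) (I : Finset β)
    (hI : (I.card : ZMod 2) = t) (hst : t ≠ s) : f I = 0 := by
  by_contra h
  exact hst (hI ▸ hf I h)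

theorem hasParity_zero_iff {f : Grassmann β} : f.HasParity 0 ↔ f.involution = f := by
  refine ⟨fun h => ext' fun I => ?_, fun h I hI => ?_⟩
  · rw [involution_apply]
    rcases Nat.even_or_odd I.card with e | o
    · rw [e.neg_one_pow, one_mul]
    · rw [h.eq_zero I (ZMod.natCast_eq_one_iff_odd.2 o) (by decide), mul_zero]
  · rw [ZMod.natCast_eq_zero_iff_even]
    by_contra ho
    have h1 := congrFun h I
    rw [involution_apply, (Nat.not_even_iff_odd.1 ho).neg_one_pow] at h1
    exact hI (by linarith)

/-- The Koszul sign `(-1) ^ s`. -/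
def parSign (s : ZMod 2) : ℝ := if s = 0 then 1 else -1

@[simp] theorem parSign_zero : parSign 0 = 1 := rfl
@[simp] theorem parSign_one : parSign 1 = -1 := by simp [parSign]

theorem zmod_two_cases (s : ZMod 2) : s = 0 ∨ s = 1 := by
  revert s; decide

theorem parSign_natCast (n : ℕ) : parSign (n : ZMod 2) = (-1) ^ n := by
  rcases Nat.even_or_odd n with e | o
  · rw [ZMod.natCast_eq_zero_iff_even.2 e, e.neg_one_pow, parSign_zero]
  · rw [ZMod.natCast_eq_one_iff_odd.2 o, o.neg_one_pow, parSign_one]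

theorem parSign_add (s t : ZMod 2) : parSign (s + t) = parSign s * parSign t := by
  rcases zmod_two_cases s with rfl | rfl <;> rcases zmod_two_cases t with rfl | rfl <;>
    simp [show (1 : ZMod 2) + 1 = 0 from by decide]

/-- The parity involution if `s` is odd, the identity if `s` is even. -/
def twist (s : ZMod 2) (f : Grassmann β) : Grassmann β := if s = 0 then f else f.involution

@[simp] theorem twist_zero (f : Grassmann β) : twist 0 f = f := rfl
@[simp] theorem twist_one (f : Grassmann β) : twist 1 f = f.involution := by simp [twist]

variable [Fintype β]

theorem HasParity.involution_eq {s : ZMod 2} {f : Grassmann β} (hf : f.HasParity s) :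
    f.involution = parSign s • f := by
  refine ext' fun I => ?_
  rw [involution_apply, smul_apply]
  by_cases h : f I = 0
  · simp [h]
  · rw [← hf I h, parSign_natCast]

theorem hasParity_one_iff {f : Grassmann β} : f.HasParity 1 ↔ f.involution = -f := by
  refine ⟨fun h => by rw [h.involution_eq, parSign_one, neg_one_smul], fun h I hI => ?_⟩
  rw [ZMod.natCast_eq_one_iff_odd]
  by_contra ho
  have h1 := congrFun h I
  rw [involution_apply, (Nat.not_odd_iff_even.1 ho).neg_one_pow, neg_apply] at h1
  exact hI (by linarith)

/-- Parity as an eigenvalue equation. This turns a condition on supports into a linear identity that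
can be added, multiplied, differentiated and pulled back. -/
theorem hasParity_iff {s : ZMod 2} {f : Grassmann β} :
    f.HasParity s ↔ f.involution = parSign s • f := by
  rcases zmod_two_cases s with rfl | rfl
  · simp [hasParity_zero_iff]
  · simp [hasParity_one_iff]

/-- The parity involution as a linear map. -/
def involutionL : Grassmann β →ₗ[ℝ] Grassmann β where
  toFun := involution
  map_add' f g := ext' fun I => by simp only [involution_apply, add_apply]; ring
  map_smul' r f := ext' fun I => by
    simp only [involution_apply, smul_apply, RingHom.id_apply]; ring

/-- The operator `∑_b θ_b ∂/∂θ_b`, multiplication by the degree. -/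
def eulerL : Grassmann β →ₗ[ℝ] Grassmann β where
  toFun f I := I.card * f I
  map_add' _ _ := ext' fun _ => mul_add _ _ _
  map_smul' _ _ := ext' fun _ => mul_left_comm _ _ _

theorem eulerL_apply (f : Grassmann β) (I : Finset β) : eulerL f I = I.card * f I := rfl

theorem involution_add (f g : Grassmann β) :
    (f + g).involution = f.involution + g.involution := involutionL.map_add f g
theorem involution_smul (r : ℝ) (f : Grassmann β) :
    (r • f).involution = r • f.involution := involutionL.map_smul r f
theorem involution_neg (f : Grassmann β) : (-f).involution = -f.involution :=
  involutionL.map_neg f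
theorem involution_sum {ι : Type*} (s : Finset ι) (f : ι → Grassmann β) :
    (∑ i ∈ s, f i).involution = ∑ i ∈ s, (f i).involution := map_sum involutionL f s

theorem HasParity.twist_eq {s : ZMod 2} {f : Grassmann β} (hf : f.HasParity s) (t : ZMod 2) :
    twist t f = parSign (t * s) • f := by
  rcases zmod_two_cases t with rfl | rfl
  · simp
  · simp [hf.involution_eq]

theorem HasParity.add {s : ZMod 2} {f g : Grassmann β} (hf : f.HasParity s) (hg : g.HasParity s) :
    (f + g).HasParity s := by
  rw [hasParity_iff] at *; rw [involution_add, hf, hg, smul_add]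

theorem HasParity.smul {s : ZMod 2} {f : Grassmann β} (r : ℝ) (hf : f.HasParity s) :
    (r • f).HasParity s := by
  rw [hasParity_iff] at *; rw [involution_smul, hf, smul_comm]

theorem HasParity.neg {s : ZMod 2} {f : Grassmann β} (hf : f.HasParity s) :
    (-f).HasParity s := by
  rw [hasParity_iff] at *; rw [involution_neg, hf, smul_neg]

theorem HasParity.sub {s : ZMod 2} {f g : Grassmann β} (hf : f.HasParity s)
    (hg : g.HasParity s) : (f - g).HasParity s := by
  rw [sub_eq_add_neg]; exact hf.add hg.neg

theorem HasParity.sum {ι : Type*} {t : Finset ι} {s : ZMod 2} {f : ι → Grassmann β}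
    (hf : ∀ i ∈ t, (f i).HasParity s) : (∑ i ∈ t, f i).HasParity s := by
  rw [hasParity_iff, involution_sum, Finset.smul_sum]
  exact Finset.sum_congr rfl fun i hi => (hf i hi).involution_eq

end Parity

section Mul

variable [LinearOrder β] [Fintype β]

theorem involution_mul (f g : Grassmann β) :
    (f * g).involution = f.involution * g.involution := by
  refine ext' fun K => ?_
  simp only [involution_apply, mul_apply, Finset.mul_sum]
  refine Finset.sum_congr rfl fun I hI => ?_
  rw [← Finset.card_sdiff_add_card_eq_card (Finset.mem_powerset.1 hI), pow_add]
  ring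

theorem involution_one : (1 : Grassmann β).involution = 1 := by
  refine ext' fun I => ?_
  rw [involution_apply, one_apply]
  split_ifs with h <;> simp [h]

theorem eulerL_mul (f g : Grassmann β) : eulerL (f * g) = eulerL f * g + f * eulerL g := by
  refine ext' fun K => ?_
  simp only [eulerL_apply, mul_apply, add_apply, Finset.mul_sum, ← Finset.sum_add_distrib]
  refine Finset.sum_congr rfl fun I hI => ?_
  rw [← Finset.card_sdiff_add_card_eq_card (Finset.mem_powerset.1 hI)]
  push_cast
  ring

theorem eulerL_one : eulerL (1 : Grassmann β) = 0 := by
  refine ext' fun I => ?_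
  rw [eulerL_apply, one_apply]
  split_ifs with h <;> simp [h, zero_apply]

theorem HasParity.mul {s t : ZMod 2} {f g : Grassmann β} (hf : f.HasParity s)
    (hg : g.HasParity t) : (f * g).HasParity (s + t) := by
  rw [hasParity_iff] at *
  rw [involution_mul, hf, hg, smul_mul_assoc, mul_smul_comm, smul_smul, parSign_add]

theorem hasParity_one : (1 : Grassmann β).HasParity 0 := hasParity_zero_iff.2 involution_one

/-- Reindexing by complements in `K`; this is graded commutativity before any parity is assumed. -/
theorem mul_apply_swap (f g : Grassmann β) (K : Finset β) :
    (f * g) K = ∑ I ∈ K.powerset,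
      (-1) ^ ((K \ I).card * I.card) * (sign I (K \ I) * f (K \ I) * g I) := by
  rw [mul_apply]
  refine Finset.sum_nbij' (fun I => K \ I) (fun I => K \ I) (by simp) (by simp)
    (fun I hI => Finset.sdiff_sdiff_eq_self (Finset.mem_powerset.1 hI))
    (fun I hI => Finset.sdiff_sdiff_eq_self (Finset.mem_powerset.1 hI)) fun I hI => ?_
  rw [Finset.sdiff_sdiff_eq_self (Finset.mem_powerset.1 hI), sign_swap Finset.disjoint_sdiff]
  ring

theorem HasParity.mul_comm {f : Grassmann β} (hf : f.HasParity 0) (g : Grassmann β) :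
    f * g = g * f := by
  refine ext' fun K => ?_
  rw [mul_apply_swap, mul_apply]
  refine Finset.sum_congr rfl fun I _ => ?_
  by_cases h : f (K \ I) = 0
  · simp [h]
  · rw [((ZMod.natCast_eq_zero_iff_even.1 (hf _ h)).mul_right _).neg_one_pow]
    ring

theorem HasParity.mul_anticomm {f : Grassmann β} (hf : f.HasParity 1) (g : Grassmann β) :
    f * g = g.involution * f := by
  refine ext' fun K => ?_
  rw [mul_apply_swap, mul_apply]
  refine Finset.sum_congr rfl fun I _ => ?_
  by_cases h : f (K \ I) = 0
  · simp [h]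
  · rw [pow_mul, (ZMod.natCast_eq_one_iff_odd.1 (hf _ h)).neg_one_pow, involution_apply]
    ring

theorem HasParity.mul_swap {s t : ZMod 2} {f g : Grassmann β} (hf : f.HasParity s)
    (hg : g.HasParity t) : f * g = parSign (s * t) • (g * f) := by
  rcases zmod_two_cases s with rfl | rfl
  · simp [hf.mul_comm]
  · rw [hf.mul_anticomm, hg.involution_eq, one_mul, smul_mul_assoc]

/-- An element of parity `s` moves past a derivative, of degree `t`, of such an element. -/
theorem HasParity.twist_mul {s t : ZMod 2} {f d : Grassmann β} (hf : f.HasParity s)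
    (hd : d.HasParity (s + t)) : twist t f * d = parSign s • (d * f) := by
  rw [hf.twist_eq, smul_mul_assoc, hf.mul_swap hd, smul_smul, ← parSign_add]
  congr 2
  clear hf hd
  revert s t; decide

theorem HasParity.twist_mul_even {t : ZMod 2} {f : Grassmann β} (hf : f.HasParity 0)
    (d : Grassmann β) : twist t f * d = d * f := by
  rw [hf.twist_eq, mul_zero, parSign_zero, one_smul, hf.mul_comm]

/-- Multiplication as a continuous bilinear map. -/
noncomputable def mulL : Grassmann β →L[ℝ] Grassmann β →L[ℝ] Grassmann β :=
  LinearMap.toContinuousBilinearMap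
    (LinearMap.mk₂ ℝ (fun f g => f * g) add_mul smul_mul_assoc mul_add
      (fun c m n => mul_smul_comm c m n))

theorem mulL_apply (f g : Grassmann β) : mulL f g = f * g := rfl

/-- The left derivative as a linear map. -/
def leftDerivL (b : β) : Grassmann β →ₗ[ℝ] Grassmann β where
  toFun := leftDeriv b
  map_add' f g := ext' fun I => by
    simp only [leftDeriv_apply, add_apply]; split_ifs <;> ring
  map_smul' r f := ext' fun I => by
    simp only [leftDeriv_apply, smul_apply, RingHom.id_apply]; split_ifs <;> ring

theorem leftDeriv_add (b : β) (f g : Grassmann β) :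
    (f + g).leftDeriv b = f.leftDeriv b + g.leftDeriv b := (leftDerivL b).map_add f g
theorem leftDeriv_smul (b : β) (r : ℝ) (f : Grassmann β) :
    (r • f).leftDeriv b = r • f.leftDeriv b := (leftDerivL b).map_smul r f
theorem leftDeriv_involution (b : β) (f : Grassmann β) :
    f.involution.leftDeriv b = -(f.leftDeriv b).involution := by
  refine ext' fun I => ?_
  simp only [leftDeriv_apply, involution_apply, neg_apply]
  split_ifs with h
  · simp
  · rw [Finset.card_insert_of_notMem h, pow_succ]; ring

theorem leftDeriv_one (b : β) : (1 : Grassmann β).leftDeriv b = 0 := by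
  refine ext' fun I => ?_
  rw [leftDeriv_apply, one_apply, if_neg (Finset.insert_ne_empty b I), mul_zero, ite_self]; rfl

theorem leftDeriv_gen (b c : β) : (gen c).leftDeriv b = if b = c then 1 else 0 := by
  refine ext' fun I => ?_
  rw [leftDeriv_apply, gen]
  by_cases hI : I = ∅
  · subst hI
    by_cases hb : b = c
    · subst hb; simp [one_apply]
    · simp [hb, zero_apply]
  · have h1 : (if b = c then (1 : Grassmann β) else 0) I = 0 := by
      split_ifs
      · simp [one_apply, hI]
      · rfl
    rw [h1]
    split_ifs with h2 h3
    · rfl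
    · exfalso
      obtain ⟨x, hx⟩ := Finset.nonempty_iff_ne_empty.2 hI
      have e1 : b = c := Finset.mem_singleton.1 (h3.subset (Finset.mem_insert_self b I))
      have e2 : x = c := Finset.mem_singleton.1 (h3.subset (Finset.mem_insert_of_mem hx))
      exact h2 (by rw [e1, ← e2]; exact hx)
    · simp

theorem hasParity_gen (b : β) : (gen b).HasParity 1 := by
  intro I hI
  have : I = {b} := by
    by_contra h; exact hI (if_neg h)
  simp [this]

/-- Compare coefficients of `θ_K`. If `b ∈ K` the left side is zero and the two contributions on the
right cancel in pairs, `b` being in one factor or the other. If `b ∉ K`, the subsets of `insert b K`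
split into those containing `b`, where `f` is differentiated, and the others, where `θ_b` first
passes `f` and produces the involution. -/
theorem leftDeriv_mul (b : β) (f g : Grassmann β) :
    (f * g).leftDeriv b = f.leftDeriv b * g + f.involution * g.leftDeriv b := by
  refine ext' fun K => ?_
  rw [add_apply, leftDeriv_apply]
  by_cases hb : b ∈ K
  · obtain ⟨K', hK', rfl⟩ : ∃ K', b ∉ K' ∧ K = insert b K' :=
      ⟨K.erase b, Finset.notMem_erase b K, (Finset.insert_erase hb).symm⟩
    rw [if_pos hb, mul_apply, mul_apply, Finset.sum_powerset_insert hK',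
      Finset.sum_powerset_insert hK']
    have z1 : ∀ I ∈ K'.powerset, sign (insert b I) (insert b K' \ insert b I) *
        f.leftDeriv b (insert b I) * g (insert b K' \ insert b I) = 0 := fun I _ => by
      simp [leftDeriv_apply]
    have z2 : ∀ I ∈ K'.powerset, sign I (insert b K' \ I) *
        f.involution I * g.leftDeriv b (insert b K' \ I) = 0 := fun I hI => by
      have : b ∉ I := fun h => hK' (Finset.mem_powerset.1 hI h)
      simp [leftDeriv_apply, this]
    rw [Finset.sum_eq_zero z1, Finset.sum_eq_zero z2, add_zero, zero_add,
      ← Finset.sum_add_distrib]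
    refine (Finset.sum_eq_zero fun I hI => ?_).symm
    rw [Finset.mem_powerset] at hI
    have hbI : b ∉ I := fun h => hK' (hI h)
    have hbI' : b ∉ K' \ I := fun h => hK' (Finset.sdiff_subset h)
    have e1 : insert b K' \ I = {b} ∪ (K' \ I) := by
      rw [Finset.insert_sdiff_of_notMem _ hbI, Finset.insert_eq]
    have e2 : insert b K' \ insert b I = K' \ I := by
      ext x; simp only [Finset.mem_sdiff, Finset.mem_insert]
      by_cases hx : x = b
      · subst hx; simp [hK']
      · simp [hx]
    have e3 : sign I {b} = (-1) ^ I.card * sign {b} I := by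
      rw [sign_swap (Finset.disjoint_singleton_right.2 hbI)]; simp
    have e4 := sign_mul_self {b} I
    have e5 := sign_mul_self {b} (K' \ I)
    rw [e2, leftDeriv_apply, leftDeriv_apply, if_neg hbI, if_neg hbI', e1,
      sign_union_right _ (Finset.disjoint_singleton_left.2 hbI'), involution_apply,
      Finset.card_insert_of_notMem hbI, Finset.insert_eq b I, Finset.insert_eq b (K' \ I),
      sign_union_left _ (Finset.disjoint_singleton_left.2 hbI), e3, pow_succ]
    linear_combination (-1) ^ I.card * sign I (K' \ I) * f ({b} ∪ I) * g ({b} ∪ K' \ I) * e4 -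
      (-1) ^ I.card * sign I (K' \ I) * f ({b} ∪ I) * g ({b} ∪ K' \ I) * e5
  · rw [if_neg hb, mul_apply, mul_apply, mul_apply, Finset.sum_powerset_insert hb, add_comm,
      mul_add, Finset.mul_sum, Finset.mul_sum]
    congr 1
    all_goals
      refine Finset.sum_congr rfl fun I hI => ?_
      rw [Finset.mem_powerset] at hI
      have hbI : b ∉ I := fun h => hb (hI h)
      have hbI' : b ∉ K \ I := fun h => hb (Finset.sdiff_subset h)
      have e1 : insert b K \ I = {b} ∪ (K \ I) := by
        rw [Finset.insert_sdiff_of_notMem _ hbI, Finset.insert_eq]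
      have e2 : insert b K \ insert b I = K \ I := by
        ext x; simp only [Finset.mem_sdiff, Finset.mem_insert]
        by_cases hx : x = b
        · subst hx; simp [hb]
        · simp [hx]
      have e3 : sign I {b} = (-1) ^ I.card * sign {b} I := by
        rw [sign_swap (Finset.disjoint_singleton_right.2 hbI)]; simp
      have e4 := sign_mul_self {b} I
      have e5 := sign_mul_self {b} (K \ I)
      have e6 : sign {b} K = sign {b} I * sign {b} (K \ I) := by
        rw [← sign_union_right _ Finset.disjoint_sdiff, Finset.union_sdiff_of_subset hI]
    · rw [e2, leftDeriv_apply, if_neg hbI, e6, Finset.insert_eq b I,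
        sign_union_left _ (Finset.disjoint_singleton_left.2 hbI)]
      linear_combination
        sign {b} I * sign I (K \ I) * f ({b} ∪ I) * g (K \ I) * e5
    · rw [leftDeriv_apply, if_neg hbI', e6, e1, involution_apply, Finset.insert_eq b (K \ I),
        sign_union_right _ (Finset.disjoint_singleton_left.2 hbI'), e3]
      linear_combination (-1) ^ I.card * sign {b} (K \ I) * sign I (K \ I) * f I *
        g ({b} ∪ K \ I) * e4

end Mul

end Grassmann

/-! ### The filtration by order and nilpotency -/

namespace Grassmann

variable {β : Type*} [LinearOrder β] [Fintype β]

/-- All components of degree less than `n` vanish. -/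
def OrderGE (n : ℕ) (f : Grassmann β) : Prop := ∀ I, I.card < n → f I = 0

theorem OrderGE.mul {m n : ℕ} {f g : Grassmann β} (hf : OrderGE m f) (hg : OrderGE n g) :
    OrderGE (m + n) (f * g) := by
  intro K hK
  rw [mul_apply]
  refine Finset.sum_eq_zero fun I hI => ?_
  rw [← Finset.card_sdiff_add_card_eq_card (Finset.mem_powerset.1 hI)] at hK
  rcases lt_or_ge I.card m with h | h
  · rw [hf I h]; ring
  · rw [hg (K \ I) (by omega)]; ring

theorem OrderGE.sum {ι : Type*} {s : Finset ι} {n : ℕ} {f : ι → Grassmann β}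
    (hf : ∀ i ∈ s, OrderGE n (f i)) : OrderGE n (∑ i ∈ s, f i) := by
  intro K hK
  rw [sum_apply]
  exact Finset.sum_eq_zero fun i hi => hf i hi K hK

theorem OrderGE.eq_zero {n : ℕ} {f : Grassmann β} (hf : OrderGE n f) (hn : Fintype.card β < n) :
    f = 0 :=
  ext' fun I => hf I ((Finset.card_le_univ I).trans_lt hn)

theorem orderGE_zero (f : Grassmann β) : OrderGE 0 f := fun _ h => (Nat.not_lt_zero _ h).elim

theorem orderGE_one_iff {f : Grassmann β} : OrderGE 1 f ↔ f ∅ = 0 := by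
  refine ⟨fun h => h ∅ (by simp), fun h I hI => ?_⟩
  rw [Finset.card_eq_zero.1 (Nat.lt_one_iff.1 hI), h]

theorem orderGE_one_eulerL (f : Grassmann β) : OrderGE 1 (eulerL f) :=
  orderGE_one_iff.2 (by simp [eulerL_apply])

theorem soul_apply_empty (f : Grassmann β) : f.soul ∅ = 0 := by
  simp [soul, sub_apply, smul_apply, one_apply, body]

theorem soul_add_body (f : Grassmann β) : f.body • 1 + f.soul = f := add_sub_cancel _ _

theorem HasParity.soul {f : Grassmann β} (hf : f.HasParity 0) : f.soul.HasParity 0 :=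
  hf.sub (hasParity_one.smul _)

/-- Evenness excludes degree one. The gain of two per soul, instead of one, is what makes the top
Taylor term vanish in the chain rule. -/
theorem HasParity.orderGE_two {f : Grassmann β} (hf : f.HasParity 0) (h0 : f ∅ = 0) :
    OrderGE 2 f := by
  intro I hI
  interval_cases h : I.card
  · rw [Finset.card_eq_zero.1 h, h0]
  · exact hf.eq_zero I (t := 1) (by simp [h]) (by decide)

theorem HasParity.apply_empty {f : Grassmann β} (hf : f.HasParity 1) : f ∅ = 0 :=
  hf.eq_zero ∅ (t := 0) (by simp) (by decide)

theorem OrderGE.of_eulerL {n : ℕ} {f : Grassmann β} (h : OrderGE n (eulerL f)) (h0 : f ∅ = 0) :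
    OrderGE n f := by
  intro I hI
  have := h I hI
  rw [eulerL_apply, mul_eq_zero] at this
  rcases this with h1 | h1
  · rw [Finset.card_eq_zero.1 (Nat.cast_eq_zero.1 h1 : I.card = 0), h0]
  · exact h1

/-- A family of elements with zero body vanishes if the Euler operator increases its order. -/
theorem eq_zero_of_eulerL {ι : Type*} (u : ι → Grassmann β) (h0 : ∀ i, u i ∅ = 0)
    (h : ∀ n, (∀ i, OrderGE n (u i)) → ∀ i, OrderGE (n + 1) (eulerL (u i))) (i : ι) :
    u i = 0 := by
  -- The Euler operator multiplies degree `k` by `k`, so away from the body it loses no information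
  -- on the order, and the bound improves by one at each step until it exceeds the number of
  -- generators.
  have key : ∀ n, ∀ i, OrderGE n (u i) := by
    intro n
    induction n with
    | zero => exact fun i => orderGE_zero _
    | succ n ih => exact fun i => (h n ih i).of_eulerL (h0 i)
  exact (key _ i).eq_zero (Nat.lt_succ_self _)

/-- Each `θ_b ∂/∂θ_b` projects onto the monomials containing `θ_b`; summing over `b` counts the
generators in a monomial. -/
theorem eulerL_gen_mul_leftDeriv (f : Grassmann β) : ∑ b, gen b * f.leftDeriv b = eulerL f := by
  refine ext' fun K => ?_
  have key : ∀ b, (gen b * f.leftDeriv b) K = if b ∈ K then f K else 0 := by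
    intro b
    rw [mul_apply]
    split_ifs with hb
    · rw [Finset.sum_eq_single {b}]
      · have e := sign_mul_self {b} (K \ {b})
        rw [leftDeriv_apply, if_neg (by simp), Finset.insert_eq,
          Finset.union_sdiff_of_subset (by simpa using hb)]
        simp only [gen, if_true]
        linear_combination f K * e
      · intro I _ hI
        simp [gen, hI]
      · intro h
        simp [hb] at h
    · refine Finset.sum_eq_zero fun I hI => ?_
      have : I ≠ {b} := by
        rintro rfl
        exact hb (by simpa using hI)
      simp [gen, this]
  rw [sum_apply, eulerL_apply, Finset.sum_congr rfl fun b _ => key b]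
  simp

theorem eulerL_gen (b : β) : eulerL (gen b) = gen b := by
  refine ext' fun I => ?_
  rw [eulerL_apply, gen]
  split_ifs with h
  · simp [h]
  · simp

/-! ### Smooth Grassmann-valued functions -/

section Smooth

variable {E : Type*} [NormedAddCommGroup E] [NormedSpace ℝ E]

theorem contDiffAt_mul {n : ℕ∞ω} {f g : E → Grassmann β} {x : E} (hf : ContDiffAt ℝ n f x)
    (hg : ContDiffAt ℝ n g x) : ContDiffAt ℝ n (fun z => f z * g z) x :=
  ContDiffAt.comp (g := fun p : Grassmann β × Grassmann β => mulL p.1 p.2) x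
    mulL.isBoundedBilinearMap.contDiff.contDiffAt (hf.prodMk hg)

theorem contDiffAt_linear {n : ℕ∞ω} {F : Type*} [NormedAddCommGroup F] [NormedSpace ℝ F]
    (T : Grassmann β →ₗ[ℝ] F) {f : E → Grassmann β} {x : E}
    (hf : ContDiffAt ℝ n f x) : ContDiffAt ℝ n (fun z => T (f z)) x :=
  (LinearMap.toContinuousLinearMap T).contDiff.contDiffAt.comp x hf

theorem fderiv_linear {F : Type*} [NormedAddCommGroup F] [NormedSpace ℝ F]
    (T : Grassmann β →ₗ[ℝ] F) {f : E → Grassmann β} {x : E}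
    (hf : DifferentiableAt ℝ f x) (v : E) :
    fderiv ℝ (fun z => T (f z)) x v = T (fderiv ℝ f x v) := by
  have := ((LinearMap.toContinuousLinearMap T).hasFDerivAt.comp x hf.hasFDerivAt).fderiv
  exact congrArg (fun L : E →L[ℝ] F => L v) this

theorem fderiv_mul_apply {f g : E → Grassmann β} {x : E} (hf : DifferentiableAt ℝ f x)
    (hg : DifferentiableAt ℝ g x) (v : E) :
    fderiv ℝ (fun z => f z * g z) x v = fderiv ℝ f x v * g x + f x * fderiv ℝ g x v := by
  have := mulL.fderiv_of_bilinear hf hg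
  refine (congrArg (fun L : E →L[ℝ] Grassmann β => L v) this).trans ?_
  exact add_comm _ _

/-- The components of an element, as linear forms. -/
def componentL (I : Finset β) : Grassmann β →ₗ[ℝ] ℝ where
  toFun f := f I
  map_add' _ _ := rfl
  map_smul' _ _ := rfl

end Smooth

end Grassmann

section Superdomains

open Grassmann

namespace SFun

/-! ### Ordered products of odd elements -/

section OddProd

variable {β β' : Type*} [LinearOrder β] [Fintype β] [LinearOrder β']

theorem oddProd_empty (η : β' → Grassmann β) : oddProd η ∅ = 1 := by simp [oddProd]

theorem oddProd_insert (η : β' → Grassmann β) {b : β'} {J : Finset β'} (h : ∀ c ∈ J, b < c) :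
    oddProd η (insert b J) = η b * oddProd η J := by
  rw [oddProd, Finset.sort_insert _ (fun c hc => (h c hc).le) fun hb => lt_irrefl _ (h b hb),
    List.map_cons, List.prod_cons]
  rfl

theorem oddProd_apply_empty {η : β' → Grassmann β} (hη : ∀ b, (η b).HasParity 1)
    (J : Finset β') : oddProd η J ∅ = if J = ∅ then 1 else 0 := by
  induction J using Finset.induction_on_min with
  | empty => simp [oddProd_empty, one_apply]
  | insert b J h ih =>
    rw [oddProd_insert η h, mul_apply]
    simp [(hη b).apply_empty]

theorem contDiffAt_oddProd {E : Type*} [NormedAddCommGroup E] [NormedSpace ℝ E] {n : ℕ∞ω}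
    {η : β' → E → Grassmann β} {x : E} (hη : ∀ b, ContDiffAt ℝ n (η b) x) (J : Finset β') :
    ContDiffAt ℝ n (fun z => oddProd (fun b => η b z) J) x := by
  induction J using Finset.induction_on_min with
  | empty => simpa only [oddProd_empty] using contDiffAt_const
  | insert b J h ih =>
    simp only [oddProd_insert _ h]
    exact contDiffAt_mul (hη b) ih

end OddProd

end SFun

/-! ### Partial derivatives and point derivations on superdomains -/

namespace SFun

variable {α β : Type*} [Fintype α] [DecidableEq α] [Fintype β] [LinearOrder β]

open Filter Topology

theorem pd_inl_apply (a : α) (f : SFun α β) (x : α → ℝ) :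
    pd (.inl a) f x = fderiv ℝ f x (Pi.single a 1) := rfl

theorem pd_inr_apply (b : β) (f : SFun α β) (x : α → ℝ) :
    pd (.inr b) f x = (f x).leftDeriv b := rfl

theorem pd_congr_of_eventuallyEq {f g : SFun α β} {x : α → ℝ} (h : f =ᶠ[𝓝 x] g) (c : α ⊕ β) :
    pd c f x = pd c g x := by
  cases c with
  | inl a => rw [pd_inl_apply, pd_inl_apply, h.fderiv_eq]
  | inr b => rw [pd_inr_apply, pd_inr_apply, h.eq_of_nhds]

theorem pd_congr {U : Set (α → ℝ)} (hU : IsOpen U) {f g : SFun α β} (h : Set.EqOn f g U)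
    (c : α ⊕ β) : Set.EqOn (pd c f) (pd c g) U := fun _ hx =>
  pd_congr_of_eventuallyEq (h.eventuallyEq_of_mem (hU.mem_nhds hx)) c

theorem contDiffAt_pd {f : SFun α β} {x : α → ℝ} (hf : ContDiffAt ℝ ∞ f x) (c : α ⊕ β) :
    ContDiffAt ℝ ∞ (pd c f) x := by
  cases c with
  | inl a =>
    exact (hf.fderiv_right (m := ∞) (by simp)).clm_apply contDiffAt_const
  | inr b => exact contDiffAt_linear (leftDerivL b) hf

theorem contDiffOn_pd {U : Set (α → ℝ)} (hU : IsOpen U) {f : SFun α β}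
    (hf : ContDiffOn ℝ ∞ f U) (c : α ⊕ β) : ContDiffOn ℝ ∞ (pd c f) U := fun _ hx =>
  (contDiffAt_pd (hf.contDiffAt (hU.mem_nhds hx)) c).contDiffWithinAt

theorem pd_add {f g : SFun α β} {x : α → ℝ} (hf : DifferentiableAt ℝ f x)
    (hg : DifferentiableAt ℝ g x) (c : α ⊕ β) : pd c (f + g) x = pd c f x + pd c g x := by
  cases c with
  | inl a => rw [pd_inl_apply, fderiv_add hf hg]; rfl
  | inr b => exact leftDeriv_add b _ _

theorem pd_smul {f : SFun α β} {x : α → ℝ} (hf : DifferentiableAt ℝ f x) (r : ℝ)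
    (c : α ⊕ β) : pd c (r • f) x = r • pd c f x := by
  cases c with
  | inl a => rw [pd_inl_apply, fderiv_const_smul hf]; rfl
  | inr b => exact leftDeriv_smul b _ _

theorem pd_mul {f g : SFun α β} {x : α → ℝ} (hf : DifferentiableAt ℝ f x)
    (hg : DifferentiableAt ℝ g x) (c : α ⊕ β) :
    pd c (f * g) x = pd c f x * g x + twist (coordParity c) (f x) * pd c g x := by
  cases c with
  | inl a => exact fderiv_mul_apply hf hg _
  | inr b =>
    have := leftDeriv_mul b (f x) (g x)
    rwa [← twist_one (f x)] at this

theorem pd_involution {f : SFun α β} {x : α → ℝ} (hf : DifferentiableAt ℝ f x) (c : α ⊕ β) :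
    pd c (fun z => (f z).involution) x = parSign (coordParity c) • (pd c f x).involution := by
  cases c with
  | inl a =>
    exact (fderiv_linear involutionL hf _).trans (one_smul _ _).symm
  | inr b =>
    exact (leftDeriv_involution b (f x)).trans (by simp [coordParity, pd_inr_apply])

/-- Differentiate the eigenvalue equation for the involution, which holds in a neighbourhood of `x`;
an odd derivative anticommutes with the involution. -/
theorem hasParity_pd {f : SFun α β} {x : α → ℝ} {s : ZMod 2}
    (hf : DifferentiableAt ℝ f x) (h : ∀ᶠ z in 𝓝 x, (f z).HasParity s) (c : α ⊕ β) :
    (pd c f x).HasParity (s + coordParity c) := by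
  have e : (fun z => (f z).involution) =ᶠ[𝓝 x] parSign s • f :=
    h.mono fun z hz => hz.involution_eq
  have h1 := pd_involution hf c
  rw [pd_congr_of_eventuallyEq e, pd_smul hf] at h1
  rw [hasParity_iff, add_comm, parSign_add, mul_smul, h1, smul_smul, ← parSign_add]
  rcases zmod_two_cases (coordParity c) with h | h <;>
    simp [h, show (1 : ZMod 2) + 1 = 0 from by decide]

theorem hasParityOn_pd {U : Set (α → ℝ)} (hU : IsOpen U) {f : SFun α β} {s : ZMod 2}
    (hf : ContDiffOn ℝ ∞ f U) (h : HasParityOn s f U) (c : α ⊕ β) :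
    HasParityOn (s + coordParity c) (pd c f) U := fun _ hx =>
  hasParity_pd ((hf.contDiffAt (hU.mem_nhds hx)).differentiableAt (by simp))
    (eventually_of_mem (hU.mem_nhds hx) h) c

theorem pd_inl_comm {f : SFun α β} {x : α → ℝ} (hf : ContDiffAt ℝ ∞ f x) (a : α) (c : α ⊕ β) :
    pd (.inl a) (pd c f) x = pd c (pd (.inl a) f) x := by
  cases c with
  | inl a' =>
    have hs := hf.isSymmSndFDerivAt (by
      simp only [minSmoothness_of_isRCLikeNormedField]
      exact WithTop.coe_le_coe.2 (le_top : (2 : ℕ∞) ≤ ⊤))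
    have hd : DifferentiableAt ℝ (fderiv ℝ f) x :=
      (hf.fderiv_right (m := ∞) (by simp)).differentiableAt (by simp)
    have key : ∀ v w, fderiv ℝ (fun z => fderiv ℝ f z v) x w = fderiv ℝ (fderiv ℝ f) x w v := by
      intro v w
      rw [fderiv_clm_apply hd (differentiableAt_const v)]
      simp
    exact (key _ _).trans ((hs.eq _ _).trans (key _ _).symm)
  | inr b => exact fderiv_linear (leftDerivL b) (hf.differentiableAt (by simp)) _

theorem pd_coord (c d : α ⊕ β) (x : α → ℝ) :
    pd c (coord d) x = if c = d then 1 else 0 := by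
  cases c with
  | inl a =>
    cases d with
    | inl a' =>
      have h : HasFDerivAt (coord (.inl a') : SFun α β)
          ((ContinuousLinearMap.proj a' : (α → ℝ) →L[ℝ] ℝ).smulRight (1 : Grassmann β)) x :=
        ((ContinuousLinearMap.proj a' : (α → ℝ) →L[ℝ] ℝ).smulRight
          (1 : Grassmann β)).hasFDerivAt
      rw [pd_inl_apply, h.fderiv]
      by_cases e : a = a'
      · subst e; simp
      · simp [e, Ne.symm e]
    | inr b =>
      have : fderiv ℝ (coord (.inr b) : SFun α β) x = 0 := fderiv_const_apply _
      rw [pd_inl_apply, this]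
      simp
  | inr b =>
    cases d with
    | inl a =>
      rw [pd_inr_apply, coord, leftDeriv_smul, leftDeriv_one]
      simp
    | inr b' =>
      rw [pd_inr_apply, coord, leftDeriv_gen]
      simp

theorem contDiff_coord (c : α ⊕ β) : ContDiff ℝ ∞ (coord c : SFun α β) := by
  cases c with
  | inl a => exact (contDiff_apply ℝ ℝ a).smul contDiff_const
  | inr b => exact contDiff_const

theorem hasParity_coord (c : α ⊕ β) (x : α → ℝ) :
    (coord c x : Grassmann β).HasParity (coordParity c) := by
  cases c with
  | inl a => exact hasParity_one.smul _
  | inr b => exact hasParity_gen b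

/-- `D` is a derivation of degree `t` at `x` of the algebra of Grassmann-valued functions. -/
structure IsPointDerivation (α' : Type*) [Fintype α'] [DecidableEq α'] (t : ZMod 2) (x : α → ℝ)
    (D : SFun α β → Grassmann β) : Prop where
  congr : ∀ {f g}, f =ᶠ[𝓝 x] g → D f = D g
  add : ∀ {f g}, DifferentiableAt ℝ f x → DifferentiableAt ℝ g x → D (f + g) = D f + D g
  smul : ∀ (r : ℝ) {f}, DifferentiableAt ℝ f x → D (r • f) = r • D f
  mul : ∀ {f g}, DifferentiableAt ℝ f x → DifferentiableAt ℝ g x →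
    D (f * g) = D f * g x + twist t (f x) * D g
  comp : ∀ {h : (α' → ℝ) → ℝ} {y : (α → ℝ) → α' → ℝ}, DifferentiableAt ℝ h (y x) →
    DifferentiableAt ℝ y x → D (fun z => h (y z) • 1) =
      ∑ a, fderiv ℝ h (y x) (Pi.single a 1) • D fun z => y z a • 1
  parity : ∀ {s f}, DifferentiableAt ℝ f x → (∀ᶠ z in 𝓝 x, (f z).HasParity s) →
    (D f).HasParity (s + t)

theorem isPointDerivation_pd (α' : Type*) [Fintype α'] [DecidableEq α'] (c : α ⊕ β)
    (x : α → ℝ) :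
    IsPointDerivation α' (coordParity c) x fun f : SFun α β => pd c f x where
  congr h := pd_congr_of_eventuallyEq h c
  add hf hg := pd_add hf hg c
  smul r _ hf := pd_smul hf r c
  mul hf hg := pd_mul hf hg c
  comp {h y} hh hy := by
    cases c with
    | inl a =>
      have key : ∀ {u : (α → ℝ) → ℝ}, DifferentiableAt ℝ u x →
          pd (.inl a) (fun z => u z • (1 : Grassmann β)) x =
            fderiv ℝ u x (Pi.single a 1) • 1 := by
        intro u hu
        rw [pd_inl_apply, fderiv_smul_const hu]
        rfl
      have hyc : ∀ a', DifferentiableAt ℝ (fun z => y z a') x := fun a' =>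
        differentiableAt_pi.1 hy a'
      have hc := congrArg (fun L : (α → ℝ) →L[ℝ] ℝ => L (Pi.single a 1)) (fderiv_comp x hh hy)
      have hsum : fderiv ℝ y x (Pi.single a 1) =
          ∑ a', (fderiv ℝ y x (Pi.single a 1) a') • (Pi.single a' (1 : ℝ) : α' → ℝ) :=
        pi_eq_sum_univ' _
      have hcomp : ∀ a', fderiv ℝ (fun z => y z a') x (Pi.single a 1) =
          fderiv ℝ y x (Pi.single a 1) a' := fun a' => by
        rw [fderiv_apply hy]; rfl
      simp only [key (hyc _), smul_smul, ← Finset.sum_smul, hcomp]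
      refine (key (hh.comp x hy)).trans ?_
      congr 1
      refine hc.trans ?_
      rw [ContinuousLinearMap.comp_apply, hsum, map_sum]
      refine Finset.sum_congr rfl fun a' _ => ?_
      rw [map_smul, smul_eq_mul, mul_comm, ← hsum]
    | inr b =>
      simp [pd_inr_apply, leftDeriv_smul, leftDeriv_one]
  parity hf h := hasParity_pd hf h c

/-- The Euler operator kills multiples of `1`, so the rule for composites with real functions reads
`0 = 0`. Treating it as a derivation lets the chain rule supply the recursion behind every algebraic
property of `pull`. -/
theorem isPointDerivation_eulerL (α' : Type*) [Fintype α'] [DecidableEq α'] (x : α → ℝ) :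
    IsPointDerivation α' 0 x fun f : SFun α β => eulerL (f x) where
  congr h := by rw [h.eq_of_nhds]
  add _ _ := map_add _ _ _
  smul r _ _ := eulerL.map_smul r _
  mul _ _ := eulerL_mul _ _
  comp _ _ := by simp [eulerL_one]
  parity {s f} _ h := by
    intro I hI
    rw [add_zero]
    exact h.self_of_nhds I fun h0 => hI (by rw [eulerL_apply, h0, mul_zero])

end SFun

/-! ### Taylor jets of a substitution -/

namespace SFun

open Filter Topology

variable {α β α' β' : Type*} [Fintype α] [DecidableEq α] [Fintype β] [LinearOrder β]
  [Fintype α'] [DecidableEq α'] [Fintype β'] [LinearOrder β']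

/-- The homogeneous part of degree `k` in `ν`, times `k!`, of the Taylor expansion of the
substitution `y + ν, η` into `f`. -/
noncomputable def jet (ν : α' → Grassmann β) (η : β' → Grassmann β) :
    ℕ → SFun α' β' → (α' → ℝ) → Grassmann β
  | 0, f, y => ∑ J, f y J • oddProd η J
  | k + 1, f, y => ∑ a, ν a * jet ν η k (pd (.inl a) f) y

section Jet

variable (ν : α' → Grassmann β) (η : β' → Grassmann β)

theorem jet_zero (f : SFun α' β') (y : α' → ℝ) :
    jet ν η 0 f y = ∑ J, f y J • oddProd η J := rfl

theorem jet_succ (k : ℕ) (f : SFun α' β') (y : α' → ℝ) :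
    jet ν η (k + 1) f y = ∑ a, ν a * jet ν η k (pd (.inl a) f) y := rfl

theorem jet_congr {V : Set (α' → ℝ)} (hV : IsOpen V) (k : ℕ) {f g : SFun α' β'}
    (h : Set.EqOn f g V) : Set.EqOn (jet ν η k f) (jet ν η k g) V := by
  induction k generalizing f g with
  | zero => intro y hy; simp only [jet_zero, h hy]
  | succ k ih =>
    intro y hy
    simp only [jet_succ]
    exact Finset.sum_congr rfl fun a _ => by rw [ih (pd_congr hV h (.inl a)) hy]

theorem jet_add {V : Set (α' → ℝ)} (hV : IsOpen V) (k : ℕ) {f g : SFun α' β'}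
    (hf : ContDiffOn ℝ ∞ f V) (hg : ContDiffOn ℝ ∞ g V) {y : α' → ℝ} (hy : y ∈ V) :
    jet ν η k (f + g) y = jet ν η k f y + jet ν η k g y := by
  induction k generalizing f g with
  | zero =>
    simp only [jet_zero, ← Finset.sum_add_distrib, ← add_smul]; rfl
  | succ k ih =>
    simp only [jet_succ, ← Finset.sum_add_distrib, ← mul_add]
    refine Finset.sum_congr rfl fun a _ => ?_
    rw [← ih (contDiffOn_pd hV hf _) (contDiffOn_pd hV hg _)]
    congr 1
    refine jet_congr ν η hV k (fun z hz => ?_) hy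
    exact pd_add ((hf.contDiffAt (hV.mem_nhds hz)).differentiableAt (by simp))
      ((hg.contDiffAt (hV.mem_nhds hz)).differentiableAt (by simp)) _

theorem jet_smul {V : Set (α' → ℝ)} (hV : IsOpen V) (k : ℕ) (r : ℝ) {f : SFun α' β'}
    (hf : ContDiffOn ℝ ∞ f V) {y : α' → ℝ} (hy : y ∈ V) :
    jet ν η k (r • f) y = r • jet ν η k f y := by
  induction k generalizing f with
  | zero =>
    simp only [jet_zero, Finset.smul_sum, smul_smul]; rfl
  | succ k ih =>
    simp only [jet_succ, Finset.smul_sum, ← mul_smul_comm]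
    refine Finset.sum_congr rfl fun a _ => ?_
    rw [← ih (contDiffOn_pd hV hf _)]
    congr 1
    refine jet_congr ν η hV k (fun z hz => ?_) hy
    exact pd_smul ((hf.contDiffAt (hV.mem_nhds hz)).differentiableAt (by simp)) _ _

theorem contDiffAt_jet {E : Type*} [NormedAddCommGroup E] [NormedSpace ℝ E]
    {V : Set (α' → ℝ)} (hV : IsOpen V) (k : ℕ) {f : SFun α' β'} (hf : ContDiffOn ℝ ∞ f V)
    {x : E} {ν : α' → E → Grassmann β} {η : β' → E → Grassmann β} {y : E → α' → ℝ}
    (hν : ∀ a, ContDiffAt ℝ ∞ (ν a) x) (hη : ∀ b, ContDiffAt ℝ ∞ (η b) x)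
    (hy : ContDiffAt ℝ ∞ y x) (hyV : y x ∈ V) :
    ContDiffAt ℝ ∞ (fun z => jet (fun a => ν a z) (fun b => η b z) k f (y z)) x := by
  induction k generalizing f with
  | zero =>
    simp only [jet_zero]
    exact ContDiffAt.sum fun J _ => ContDiffAt.fun_smul
      ((contDiffAt_linear (componentL J) (hf.contDiffAt (hV.mem_nhds hyV))).comp x hy)
      (contDiffAt_oddProd hη J)
  | succ k ih =>
    simp only [jet_succ]
    exact ContDiffAt.sum fun a _ => contDiffAt_mul (hν a) (ih (contDiffOn_pd hV hf _))

theorem pd_inl_jet {V : Set (α' → ℝ)} (hV : IsOpen V) (k : ℕ) {f : SFun α' β'}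
    (hf : ContDiffOn ℝ ∞ f V) (a : α') {y : α' → ℝ} (hy : y ∈ V) :
    fderiv ℝ (jet ν η k f) y (Pi.single a 1) = jet ν η k (pd (.inl a) f) y := by
  induction k generalizing f with
  | zero =>
    have hd : ∀ J, DifferentiableAt ℝ (fun z => f z J) y := fun J =>
      (contDiffAt_linear (componentL J) (hf.contDiffAt (hV.mem_nhds hy))).differentiableAt
        (by simp)
    have h : HasFDerivAt (jet ν η 0 f)
        (∑ J, (fderiv ℝ (fun z => f z J) y).smulRight (oddProd η J)) y := by
      have := HasFDerivAt.fun_sum fun J (_ : J ∈ Finset.univ) =>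
        (hd J).hasFDerivAt.smul_const (oddProd η J)
      exact this
    rw [h.fderiv, jet_zero, _root_.sum_apply]
    refine Finset.sum_congr rfl fun J _ => ?_
    rw [ContinuousLinearMap.smulRight_apply]
    congr 1
    exact fderiv_linear (componentL J)
      ((hf.contDiffAt (hV.mem_nhds hy)).differentiableAt (by simp)) _
  | succ k ih =>
    have hd : ∀ c, DifferentiableAt ℝ (jet ν η k (pd (.inl c) f)) y := fun c =>
      (contDiffAt_jet hV k (contDiffOn_pd hV hf _) (fun _ => contDiffAt_const)
        (fun _ => contDiffAt_const) contDiffAt_id hy).differentiableAt (by simp)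
    have h : HasFDerivAt (jet ν η (k + 1) f)
        (∑ c, (mulL (ν c)).comp (fderiv ℝ (jet ν η k (pd (.inl c) f)) y)) y := by
      have := HasFDerivAt.fun_sum fun c (_ : c ∈ Finset.univ) =>
        ((mulL (ν c)).hasFDerivAt.comp y (hd c).hasFDerivAt)
      exact this
    rw [h.fderiv, jet_succ, _root_.sum_apply]
    refine Finset.sum_congr rfl fun c _ => ?_
    rw [ContinuousLinearMap.comp_apply, ih (contDiffOn_pd hV hf _), mulL_apply]
    congr 1
    refine jet_congr ν η hV k (fun z hz => ?_) hy
    exact pd_inl_comm (hf.contDiffAt (hV.mem_nhds hz)) a (.inl c)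

/-- `shiftOp` differentiates after the odd substitution, `jet` before it. They agree since `ν` and
`η` do not depend on `y`. The form with derivatives on `f` is the one suited to induction over all
`f`. -/
theorem shiftOp_iterate {V : Set (α' → ℝ)} (hV : IsOpen V) (k : ℕ) {f : SFun α' β'}
    (hf : ContDiffOn ℝ ∞ f V) :
    Set.EqOn ((shiftOp ν)^[k] fun y => ∑ J, f y J • oddProd η J) (jet ν η k f) V := by
  induction k with
  | zero => exact fun y _ => rfl
  | succ k ih =>
    intro y hy
    rw [Function.iterate_succ_apply', jet_succ]
    refine Finset.sum_congr rfl fun a _ => ?_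
    rw [(ih.eventuallyEq_of_mem (hV.mem_nhds hy)).fderiv_eq, pd_inl_jet ν η hV k hf a hy]

end Jet

/-- The souls of the even components of a tuple at a point. -/
noncomputable def evenSoul (Φ : STuple α' β' α β) (a : α') (x : α → ℝ) : Grassmann β :=
  (Φ (.inl a) x).soul

theorem pull_eq_sum_jet {V : Set (α' → ℝ)} (hV : IsOpen V) {f : SFun α' β'}
    (hf : ContDiffOn ℝ ∞ f V) (Φ : STuple α' β' α β) {x : α → ℝ} (hx : bodyMap Φ x ∈ V) :
    pull f Φ x = ∑ k ∈ Finset.range (Fintype.card β + 1), ((k.factorial : ℝ)⁻¹) •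
      jet (fun a => evenSoul Φ a x) (fun b => Φ (.inr b) x) k f (bodyMap Φ x) := by
  refine Finset.sum_congr rfl fun k _ => ?_
  exact congrArg _ (shiftOp_iterate _ _ hV k hf hx)

end SFun

/-! ### The chain rule for pull-backs -/

namespace SFun

open Filter Topology

variable {α β α' β' : Type*} [Fintype α] [DecidableEq α] [Fintype β] [LinearOrder β]
  [Fintype α'] [DecidableEq α'] [Fintype β'] [LinearOrder β']

section Derivation

variable {t : ZMod 2} {x : α → ℝ} {D : SFun α β → Grassmann β}

theorem IsPointDerivation.zero (hD : IsPointDerivation α' t x D) : D 0 = 0 := by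
  have := hD.smul 0 (f := 0) (differentiableAt_const 0)
  rwa [zero_smul, zero_smul] at this

theorem IsPointDerivation.sum (hD : IsPointDerivation α' t x D) {ι : Type*} (s : Finset ι)
    {f : ι → SFun α β} (hf : ∀ i ∈ s, DifferentiableAt ℝ (f i) x) :
    D (∑ i ∈ s, f i) = ∑ i ∈ s, D (f i) := by
  classical
  induction s using Finset.induction_on with
  | empty => simp [hD.zero]
  | insert i s hi ih =>
    rw [Finset.sum_insert hi, Finset.sum_insert hi,
      hD.add (hf i (Finset.mem_insert_self i s)) (DifferentiableAt.sum fun j hj =>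
        hf j (Finset.mem_insert_of_mem hj)),
      ih fun j hj => hf j (Finset.mem_insert_of_mem hj)]

theorem IsPointDerivation.one (hD : IsPointDerivation α' t x D) : D 1 = 0 := by
  have h := hD.comp (h := fun _ => (1 : ℝ)) (y := fun _ _ => (0 : ℝ))
    (differentiableAt_const _) (differentiableAt_const _)
  simp only [one_smul, fderiv_fun_const, Pi.zero_apply, _root_.zero_apply, zero_smul,
    Finset.sum_const_zero] at h
  exact h

/-- Leibniz rule with `D (η b)` brought to the far left: it passes the factors preceding `η b`, and
the accumulated sign is `sign {b} J` whatever the degree of `D`. -/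
theorem IsPointDerivation.oddProd (hD : IsPointDerivation α' t x D) {η : β' → SFun α β}
    (hη : ∀ b, ContDiffAt ℝ ∞ (η b) x) (hη' : ∀ b, ∀ᶠ z in 𝓝 x, (η b z).HasParity 1)
    (J : Finset β') :
    D (fun z => oddProd (fun b => η b z) J) = ∑ b ∈ J,
      D (η b) * (sign {b} J • SFun.oddProd (fun b => η b x) (J.erase b)) := by
  induction J using Finset.induction_on_min with
  | empty =>
    simp only [oddProd_empty, Finset.sum_empty]
    exact hD.one
  | insert m J h ih =>
    have hm : m ∉ J := fun hm => lt_irrefl _ (h m hm)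
    have e : (fun z => SFun.oddProd (fun b => η b z) (insert m J)) =
        η m * fun z => SFun.oddProd (fun b => η b z) J := by
      funext z; exact oddProd_insert _ h
    rw [e, hD.mul ((hη m).differentiableAt (by simp))
      ((contDiffAt_oddProd hη J).differentiableAt (by simp)), ih, Finset.sum_insert hm,
      Finset.erase_insert hm, Finset.mul_sum]
    congr 1
    · have : sign {m} (insert m J) = 1 := by
        rw [sign_eq_prod, Finset.prod_singleton]
        refine Finset.prod_eq_one fun j hj => if_neg ?_
        rcases Finset.mem_insert.1 hj with rfl | hj
        · exact lt_irrefl _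
        · exact (h j hj).not_gt
      rw [this, one_smul]
    · refine Finset.sum_congr rfl fun b hb => ?_
      have hbm : m < b := h b hb
      have e1 : sign {b} (insert m J) = -sign {b} J := by
        rw [Finset.insert_eq, sign_union_right _ (Finset.disjoint_singleton_left.2 hm),
          sign_eq_prod {b} {m}]
        simp [hbm]
      have e2 : (insert m J).erase b = insert m (J.erase b) :=
        Finset.erase_insert_of_ne hbm.ne
      rw [e1, e2, oddProd_insert _ fun c hc => h c (Finset.mem_of_mem_erase hc), ← mul_assoc,
        (hη' m).self_of_nhds.twist_mul
          (hD.parity ((hη b).differentiableAt (by simp)) (hη' b)), parSign_one]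
      simp only [mul_smul_comm, neg_smul, smul_neg, mul_neg, mul_assoc, one_smul, neg_mul]

/-- The signs from the Leibniz rule are those of the left derivative, under the bijection `J ↦
J.erase b` from sets containing `b` to sets avoiding it. -/
theorem sum_smul_sign_oddProd (η : β' → Grassmann β) (f : Grassmann β') (b : β') :
    ∑ J with b ∈ J, f J • (sign {b} J • oddProd η (J.erase b)) =
      ∑ K, f.leftDeriv b K • oddProd η K := by
  rw [← Finset.sum_filter_add_sum_filter_not Finset.univ (fun K => b ∈ K)
    (fun K => f.leftDeriv b K • oddProd η K)]
  have hz : ∑ K with b ∈ K, f.leftDeriv b K • oddProd η K = 0 :=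
    Finset.sum_eq_zero fun K hK => by
      rw [leftDeriv_apply, if_pos (Finset.mem_filter.1 hK).2, zero_smul]
  rw [hz, zero_add]
  · refine Finset.sum_nbij' (fun J => J.erase b) (fun K => insert b K) (by simp) (by simp)
      (fun J hJ => Finset.insert_erase (Finset.mem_filter.1 hJ).2)
      (fun K hK => Finset.erase_insert (Finset.mem_filter.1 hK).2) fun J hJ => ?_
    have hb := (Finset.mem_filter.1 hJ).2
    have e : sign {b} J = sign {b} (J.erase b) := by
      nth_rw 1 [← Finset.insert_erase hb]
      rw [Finset.insert_eq, sign_union_right _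
        (Finset.disjoint_singleton_left.2 (Finset.notMem_erase b J)), sign_eq_prod {b} {b}]
      simp
    rw [leftDeriv_apply, if_neg (Finset.notMem_erase b J), Finset.insert_erase hb, e, smul_smul,
      mul_comm]

variable {V : Set (α' → ℝ)} {ν : α' → SFun α β} {η : β' → SFun α β}
  {y : (α → ℝ) → α' → ℝ}

theorem IsPointDerivation.jet_zero (hD : IsPointDerivation α' t x D) (hV : IsOpen V)
    (hη : ∀ b, ContDiffAt ℝ ∞ (η b) x) (hη' : ∀ b, ∀ᶠ z in 𝓝 x, (η b z).HasParity 1)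
    (hy : ContDiffAt ℝ ∞ y x) (hyV : y x ∈ V) {f : SFun α' β'} (hf : ContDiffOn ℝ ∞ f V) :
    D (fun z => jet (fun a => ν a z) (fun b => η b z) 0 f (y z)) =
      ∑ a, D (fun z => y z a • 1) *
        jet (fun a => ν a x) (fun b => η b x) 0 (pd (.inl a) f) (y x) +
      ∑ b, D (η b) * jet (fun a => ν a x) (fun b => η b x) 0 (pd (.inr b) f) (y x) := by
  have hfy := hf.contDiffAt (hV.mem_nhds hyV)
  have hc : ∀ J, ContDiffAt ℝ ∞ (fun z => f z J) (y x) := fun J =>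
    contDiffAt_linear (componentL J) hfy
  have hu : ∀ J, ContDiffAt ℝ ∞ (fun z => f (y z) J • (1 : Grassmann β)) x := fun J =>
    ContDiffAt.fun_smul ((hc J).comp x hy) contDiffAt_const
  have hw := fun J => contDiffAt_oddProd hη J
  have e : (fun z => jet (fun a => ν a z) (fun b => η b z) 0 f (y z)) =
      ∑ J, (fun z => f (y z) J • (1 : Grassmann β)) *
        fun z => SFun.oddProd (fun b => η b z) J := by
    funext z
    rw [Finset.sum_apply, SFun.jet_zero]
    refine Finset.sum_congr rfl fun J _ => ?_
    rw [Pi.mul_apply, smul_mul_assoc, one_mul]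
  have h1 : ∀ J, D ((fun z => f (y z) J • (1 : Grassmann β)) *
        fun z => SFun.oddProd (fun b => η b z) J) =
      ∑ a, D (fun z => y z a • 1) * (pd (.inl a) f (y x) J • SFun.oddProd (fun b => η b x) J) +
      ∑ b ∈ J, D (η b) * (f (y x) J • (sign {b} J • SFun.oddProd (fun b => η b x) (J.erase b)))
      := by
    intro J
    rw [hD.mul ((hu J).differentiableAt (by simp)) ((hw J).differentiableAt (by simp)),
      hD.oddProd hη hη', hD.comp (h := fun z => f z J) ((hc J).differentiableAt (by simp))
        (hy.differentiableAt (by simp)), Finset.sum_mul, (hasParity_one.smul _).twist_mul_even,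
      mul_smul_comm, mul_one, Finset.smul_sum]
    congr 1
    · refine Finset.sum_congr rfl fun a _ => ?_
      rw [smul_mul_assoc, mul_smul_comm]
      congr 1
      exact fderiv_linear (componentL J) (hfy.differentiableAt (by simp)) _
    · exact Finset.sum_congr rfl fun b _ => (mul_smul_comm _ _ _).symm
  rw [e]
  refine (hD.sum Finset.univ fun J _ => ?_).trans ?_
  · exact (contDiffAt_mul (hu J) (hw J)).differentiableAt (by simp)
  rw [Finset.sum_congr rfl fun J _ => h1 J, Finset.sum_add_distrib, Finset.sum_comm]
  congr 1
  · exact Finset.sum_congr rfl fun a _ => (Finset.mul_sum _ _ _).symm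
  · rw [Finset.sum_comm' (t' := Finset.univ) (s' := fun b => Finset.univ.filter fun J => b ∈ J)
      (by simp)]
    refine Finset.sum_congr rfl fun b _ => ?_
    rw [← Finset.mul_sum, sum_smul_sign_oddProd]
    rfl

theorem sum_sum_mul_of_even {ι : Type*} [Fintype ι] (ν : α' → Grassmann β)
    (hν : ∀ a, (ν a).HasParity 0) (d : ι → Grassmann β) (u : α' → ι → Grassmann β) :
    ∑ a, (∑ c, d c * u a c) * ν a = ∑ c, d c * ∑ a, ν a * u a c := by
  simp only [Finset.sum_mul, Finset.mul_sum]
  rw [Finset.sum_comm]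
  refine Finset.sum_congr rfl fun c _ => Finset.sum_congr rfl fun a _ => ?_
  rw [(hν a).mul_comm, mul_assoc]

/-- The derivation can hit the base point, an odd argument or one of the `k` increments. The
increments are even and the even partial derivatives commute, so the last case gives `k` equal
terms. At `k = 0` the truncated `k - 1` is harmless because of the factor `k`. -/
theorem IsPointDerivation.jet (hD : IsPointDerivation α' t x D) (hV : IsOpen V)
    (hν : ∀ a, ContDiffAt ℝ ∞ (ν a) x) (hν' : ∀ a, (ν a x).HasParity 0)
    (hη : ∀ b, ContDiffAt ℝ ∞ (η b) x) (hη' : ∀ b, ∀ᶠ z in 𝓝 x, (η b z).HasParity 1)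
    (hy : ContDiffAt ℝ ∞ y x) (hyV : y x ∈ V) (k : ℕ) {f : SFun α' β'}
    (hf : ContDiffOn ℝ ∞ f V) :
    D (fun z => jet (fun a => ν a z) (fun b => η b z) k f (y z)) =
      ∑ a, D (fun z => y z a • 1) *
        SFun.jet (fun a => ν a x) (fun b => η b x) k (pd (.inl a) f) (y x) +
      ∑ b, D (η b) * SFun.jet (fun a => ν a x) (fun b => η b x) k (pd (.inr b) f) (y x) +
      (k : ℝ) • ∑ a, D (ν a) *
        SFun.jet (fun a => ν a x) (fun b => η b x) (k - 1) (pd (.inl a) f) (y x) := by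
  induction k generalizing f with
  | zero => rw [hD.jet_zero hV hη hη' hy hyV hf]; simp
  | succ k ih =>
    have hj := fun a => contDiffAt_jet hV k (contDiffOn_pd hV hf (.inl a)) hν hη hy hyV
    have e : (fun z => SFun.jet (fun a => ν a z) (fun b => η b z) (k + 1) f (y z)) =
        ∑ a, ν a * fun z => SFun.jet (fun a => ν a z) (fun b => η b z) k (pd (.inl a) f) (y z)
        := by
      funext z
      rw [Finset.sum_apply]
      rfl
    have hcomm : ∀ (m : ℕ) (a : α') (c : α' ⊕ β'),
        SFun.jet (fun a => ν a x) (fun b => η b x) m (pd c (pd (.inl a) f)) (y x) =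
        SFun.jet (fun a => ν a x) (fun b => η b x) m (pd (.inl a) (pd c f)) (y x) :=
      fun m a c => jet_congr _ _ hV m (fun z hz =>
        (pd_inl_comm (hf.contDiffAt (hV.mem_nhds hz)) a c).symm) hyV
    rw [e]
    refine (hD.sum Finset.univ fun a _ => ?_).trans ?_
    · exact (contDiffAt_mul (hν a) (hj a)).differentiableAt (by simp)
    have h1 : ∀ a, D (ν a * fun z =>
          SFun.jet (fun a => ν a z) (fun b => η b z) k (pd (.inl a) f) (y z)) =
        D (ν a) * SFun.jet (fun a => ν a x) (fun b => η b x) k (pd (.inl a) f) (y x) +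
        (∑ c, D (fun z => y z c • 1) *
          SFun.jet (fun a => ν a x) (fun b => η b x) k (pd (.inl a) (pd (.inl c) f))
            (y x)) * ν a x +
        (∑ b, D (η b) *
          SFun.jet (fun a => ν a x) (fun b => η b x) k (pd (.inl a) (pd (.inr b) f))
            (y x)) * ν a x +
        (k : ℝ) • ((∑ c, D (ν c) *
          SFun.jet (fun a => ν a x) (fun b => η b x) (k - 1) (pd (.inl a) (pd (.inl c) f))
            (y x)) * ν a x) := by
      intro a
      rw [hD.mul ((hν a).differentiableAt (by simp)) ((hj a).differentiableAt (by simp)),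
        (hν' _).twist_mul_even, ih (contDiffOn_pd hV hf _),
        Finset.sum_congr rfl fun c _ => congrArg _ (hcomm k a (.inl c)),
        Finset.sum_congr rfl fun c _ => congrArg _ (hcomm k a (.inr c)),
        Finset.sum_congr rfl fun c _ => congrArg _ (hcomm (k - 1) a (.inl c)),
        add_mul, add_mul, smul_mul_assoc, add_assoc, add_assoc, add_assoc]
    simp only [h1, Finset.sum_add_distrib, ← Finset.smul_sum, sum_sum_mul_of_even _ hν', ← jet_succ,
      Nat.add_sub_cancel]
    cases k with
    | zero => simp; abel
    | succ k =>
      rw [Nat.add_sub_cancel]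
      push_cast
      module

end Derivation

section ChainRule

theorem orderGE_jet {ν : α' → Grassmann β} (hν : ∀ a, OrderGE 2 (ν a)) (η : β' → Grassmann β)
    (k : ℕ) (f : SFun α' β') (y : α' → ℝ) : OrderGE (2 * k) (jet ν η k f y) := by
  induction k generalizing f with
  | zero => exact orderGE_zero _
  | succ k ih =>
    rw [mul_add, mul_one, add_comm]
    exact OrderGE.sum fun a _ => (hν a).mul (ih _)

variable {U : Set (α → ℝ)} {V : Set (α' → ℝ)} {Φ : STuple α' β' α β}

theorem IsMapOn.contDiffAt (hΦ : IsMapOn Φ U V) (hU : IsOpen U) {x : α → ℝ} (hx : x ∈ U)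
    (c : α' ⊕ β') : ContDiffAt ℝ ∞ (Φ c) x := (hΦ.smooth c).contDiffAt (hU.mem_nhds hx)

theorem IsMapOn.contDiffAt_bodyMap (hΦ : IsMapOn Φ U V) (hU : IsOpen U) {x : α → ℝ}
    (hx : x ∈ U) : ContDiffAt ℝ ∞ (bodyMap Φ) x :=
  contDiffAt_pi.2 fun a => contDiffAt_linear (componentL ∅) (hΦ.contDiffAt hU hx (.inl a))

theorem contDiffAt_soul {E : Type*} [NormedAddCommGroup E] [NormedSpace ℝ E]
    {f : E → Grassmann β} {x : E} (hf : ContDiffAt ℝ ∞ f x) :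
    ContDiffAt ℝ ∞ (fun z => (f z).soul) x :=
  hf.sub (ContDiffAt.fun_smul (contDiffAt_linear (componentL ∅) hf) contDiffAt_const)

theorem IsMapOn.contDiffAt_evenSoul (hΦ : IsMapOn Φ U V) (hU : IsOpen U) {x : α → ℝ}
    (hx : x ∈ U) (a : α') : ContDiffAt ℝ ∞ (evenSoul Φ a) x :=
  contDiffAt_soul (hΦ.contDiffAt hU hx _)

theorem IsMapOn.pull_eventuallyEq (hΦ : IsMapOn Φ U V) (hU : IsOpen U) (hV : IsOpen V)
    {f : SFun α' β'} (hf : ContDiffOn ℝ ∞ f V) {x : α → ℝ} (hx : x ∈ U) :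
    pull f Φ =ᶠ[𝓝 x] ∑ k ∈ Finset.range (Fintype.card β + 1), ((k.factorial : ℝ)⁻¹) •
      fun z => jet (fun a => evenSoul Φ a z) (fun b => Φ (.inr b) z) k f (bodyMap Φ z) :=
  eventually_of_mem (hU.mem_nhds hx) fun z hz => by
    rw [pull_eq_sum_jet hV hf Φ (hΦ.mapsTo hz), Finset.sum_apply]
    rfl

theorem IsMapOn.contDiffAt_jet (hΦ : IsMapOn Φ U V) (hU : IsOpen U) (hV : IsOpen V)
    {f : SFun α' β'} (hf : ContDiffOn ℝ ∞ f V) {x : α → ℝ} (hx : x ∈ U) (k : ℕ) :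
    ContDiffAt ℝ ∞ (fun z => jet (fun a => evenSoul Φ a z) (fun b => Φ (.inr b) z) k f
      (bodyMap Φ z)) x :=
  SFun.contDiffAt_jet hV k hf (hΦ.contDiffAt_evenSoul hU hx) (fun _ => hΦ.contDiffAt hU hx _)
    (hΦ.contDiffAt_bodyMap hU hx) (hΦ.mapsTo hx)

theorem IsMapOn.contDiffOn_pull (hΦ : IsMapOn Φ U V) (hU : IsOpen U) (hV : IsOpen V)
    {f : SFun α' β'} (hf : ContDiffOn ℝ ∞ f V) : ContDiffOn ℝ ∞ (pull f Φ) U := by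
  intro x hx
  refine ContDiffAt.contDiffWithinAt (ContDiffAt.congr_of_eventuallyEq ?_
    (hΦ.pull_eventuallyEq hU hV hf hx))
  rw [Finset.sum_fn]
  refine ContDiffAt.sum fun k _ => ?_
  exact (hΦ.contDiffAt_jet hU hV hf hx k).const_smul (k.factorial : ℝ)⁻¹

/-- The chain rule, for an arbitrary derivation. -/
theorem IsPointDerivation.pull {t : ZMod 2} {x : α → ℝ} {D : SFun α β → Grassmann β}
    (hD : IsPointDerivation α' t x D) (hΦ : IsMapOn Φ U V) (hU : IsOpen U) (hV : IsOpen V)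
    {f : SFun α' β'} (hf : ContDiffOn ℝ ∞ f V) (hx : x ∈ U) :
    D (pull f Φ) = ∑ c, D (Φ c) * SFun.pull (pd c f) Φ x := by
  have hj := fun k => (hΦ.contDiffAt_jet hU hV hf hx k).differentiableAt (by simp)
  have hb := hΦ.contDiffAt_bodyMap hU hx
  have hs := hΦ.contDiffAt_evenSoul hU hx
  have hp : ∀ a, (evenSoul Φ a x).HasParity 0 := fun a => (hΦ.parity (.inl a) x hx).soul
  -- Body and soul enter the Taylor formula in different places, as base point and as increment; the
  -- two contributions must recombine into `D (Φ (.inl a))`.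
  have hsplit : ∀ a, D (Φ (.inl a)) = D (fun z => bodyMap Φ z a • 1) + D (evenSoul Φ a) := by
    intro a
    rw [← hD.add]
    · congr 1
      funext z
      exact (soul_add_body _).symm
    · exact (ContDiffAt.fun_smul (contDiffAt_pi.1 hb a) contDiffAt_const).differentiableAt
        (by simp)
    · exact (hs a).differentiableAt (by simp)
  have hshift : ∀ a, D (evenSoul Φ a) * SFun.pull (pd (.inl a) f) Φ x =
      ∑ k ∈ Finset.range (Fintype.card β + 1), ((k.factorial : ℝ)⁻¹) • ((k : ℝ) •
        (D (evenSoul Φ a) * SFun.jet (fun a => evenSoul Φ a x) (fun b => Φ (.inr b) x) (k - 1)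
          (pd (.inl a) f) (bodyMap Φ x))) := by
    intro a
    rw [pull_eq_sum_jet hV (contDiffOn_pd hV hf _) Φ (hΦ.mapsTo hx), Finset.mul_sum,
      Finset.sum_range_succ, Finset.sum_range_succ']
    -- Since `k / k! = 1 / (k - 1)!`, the increment terms form the Taylor sum shifted by one,
    -- without its top term. That term vanishes: with no odd generators the soul is zero, otherwise
    -- its order is at least twice the number of generators.
    have hlast : D (evenSoul Φ a) * (((Fintype.card β).factorial : ℝ)⁻¹ •
        SFun.jet (fun a => evenSoul Φ a x) (fun b => Φ (.inr b) x) (Fintype.card β)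
          (pd (.inl a) f) (bodyMap Φ x)) = 0 := by
      rcases Nat.eq_zero_or_pos (Fintype.card β) with h0 | h0
      · have : evenSoul Φ a = 0 := by
          funext z
          exact OrderGE.eq_zero (orderGE_one_iff.2 (soul_apply_empty _)) (by omega)
        rw [this, hD.zero, zero_mul]
      · rw [(orderGE_jet (fun a => (hp a).orderGE_two (soul_apply_empty _)) _ _ _ _).eq_zero
          (by omega), smul_zero, mul_zero]
    rw [hlast, add_zero]
    simp only [Nat.cast_zero, zero_smul, smul_zero, add_zero, Nat.add_sub_cancel]
    refine Finset.sum_congr rfl fun k _ => ?_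
    rw [mul_smul_comm, smul_smul, Nat.factorial_succ]
    congr 1
    push_cast
    field_simp
  rw [hD.congr (hΦ.pull_eventuallyEq hU hV hf hx)]
  refine (hD.sum _ fun k _ => (hj k).const_smul _).trans ?_
  simp only [fun k r => hD.smul r (hj k), hD.jet hV hs hp (fun b => hΦ.contDiffAt hU hx _)
    (fun b => eventually_of_mem (hU.mem_nhds hx) (hΦ.parity (.inr b))) hb (hΦ.mapsTo hx) _ hf]
  rw [Fintype.sum_sum_type]
  simp only [hsplit, add_mul, hshift, Finset.sum_add_distrib]
  simp only [pull_eq_sum_jet hV (contDiffOn_pd hV hf _) Φ (hΦ.mapsTo hx), Finset.mul_sum,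
    smul_add, Finset.sum_add_distrib, Finset.smul_sum, mul_smul_comm]
  rw [Finset.sum_comm (s := Finset.range _) (t := (Finset.univ : Finset α')),
    Finset.sum_comm (s := Finset.range _) (t := (Finset.univ : Finset β')),
    Finset.sum_comm (s := Finset.range _) (t := (Finset.univ : Finset α'))]
  abel

end ChainRule

end SFun

/-! ### Further rules for parity, order and the Euler operator -/

namespace Grassmann

variable {β : Type*} [LinearOrder β] [Fintype β]

theorem involution_involution (f : Grassmann β) : f.involution.involution = f := by
  refine ext' fun I => ?_
  rw [involution_apply, involution_apply, ← mul_assoc, ← mul_pow]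
  simp

theorem mul_apply_empty (f g : Grassmann β) : (f * g) ∅ = f ∅ * g ∅ := by
  rw [mul_apply]; simp

theorem HasParity.mul_eq_mul_twist {s : ZMod 2} {d : Grassmann β} (hd : d.HasParity s)
    (f : Grassmann β) : f * d = d * twist s f := by
  rcases zmod_two_cases s with rfl | rfl
  · rw [twist_zero, hd.mul_comm]
  · rw [twist_one, hd.mul_anticomm, involution_involution]

theorem OrderGE.add {n : ℕ} {f g : Grassmann β} (hf : OrderGE n f) (hg : OrderGE n g) :
    OrderGE n (f + g) := fun I hI => by rw [add_apply, hf I hI, hg I hI, add_zero]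

theorem OrderGE.smul {n : ℕ} {f : Grassmann β} (r : ℝ) (hf : OrderGE n f) :
    OrderGE n (r • f) := fun I hI => by rw [smul_apply, hf I hI, mul_zero]

theorem OrderGE.eulerL_mul {n : ℕ} (f : Grassmann β) {g : Grassmann β} (hg : OrderGE n g) :
    OrderGE (n + 1) (eulerL f * g) := by
  rw [add_comm]
  exact (orderGE_one_eulerL f).mul hg

theorem eulerL_involution (f : Grassmann β) :
    eulerL f.involution = (eulerL f).involution := by
  refine ext' fun I => ?_
  simp only [eulerL_apply, involution_apply]
  ring

theorem HasParity.eulerL {s : ZMod 2} {f : Grassmann β} (hf : f.HasParity s) :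
    (Grassmann.eulerL f).HasParity s := by
  rw [hasParity_iff, ← eulerL_involution, hf.involution_eq, map_smul]

end Grassmann

/-! ### The pull-back as a homomorphism of superalgebras -/

namespace SFun

open Filter Topology

variable {α β α' β' : Type*} [Fintype α] [DecidableEq α] [Fintype β] [LinearOrder β]
  [Fintype α'] [DecidableEq α'] [Fintype β'] [LinearOrder β']

section Pull

variable {U : Set (α → ℝ)} {V : Set (α' → ℝ)} {Φ : STuple α' β' α β} {f g : SFun α' β'}
  {x : α → ℝ}

theorem pull_congr (hV : IsOpen V) (hf : ContDiffOn ℝ ∞ f V) (h : Set.EqOn f g V)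
    (hx : bodyMap Φ x ∈ V) : pull f Φ x = pull g Φ x := by
  rw [pull_eq_sum_jet hV hf Φ hx, pull_eq_sum_jet hV (hf.congr h.symm) Φ hx]
  exact Finset.sum_congr rfl fun k _ => by rw [jet_congr _ _ hV k h hx]

theorem pull_congr_right (f : SFun α' β') {Ψ : STuple α' β' α β} (h : ∀ c, Φ c x = Ψ c x) :
    pull f Φ x = pull f Ψ x := by
  have hb : bodyMap Φ x = bodyMap Ψ x := funext fun a => by rw [bodyMap, bodyMap, h]
  simp only [pull, h, hb]

theorem contDiffOn_add {U : Set (α → ℝ)} {f g : SFun α β}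
    (hf : ContDiffOn ℝ ∞ f U) (hg : ContDiffOn ℝ ∞ g U) : ContDiffOn ℝ ∞ (f + g) U := hf.add hg

theorem contDiffOn_smul {U : Set (α → ℝ)} (r : ℝ) {f : SFun α β}
    (hf : ContDiffOn ℝ ∞ f U) : ContDiffOn ℝ ∞ (r • f) U := hf.const_smul r

theorem pull_add (hV : IsOpen V) (hf : ContDiffOn ℝ ∞ f V) (hg : ContDiffOn ℝ ∞ g V)
    (hx : bodyMap Φ x ∈ V) : pull (f + g) Φ x = pull f Φ x + pull g Φ x := by
  rw [pull_eq_sum_jet hV hf Φ hx, pull_eq_sum_jet hV hg Φ hx,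
    pull_eq_sum_jet hV (contDiffOn_add hf hg) Φ hx, ← Finset.sum_add_distrib]
  exact Finset.sum_congr rfl fun k _ => by rw [jet_add _ _ hV k hf hg hx, smul_add]

theorem pull_smul (hV : IsOpen V) (hf : ContDiffOn ℝ ∞ f V) (r : ℝ)
    (hx : bodyMap Φ x ∈ V) : pull (r • f) Φ x = r • pull f Φ x := by
  rw [pull_eq_sum_jet hV hf Φ hx, pull_eq_sum_jet hV (contDiffOn_smul r hf) Φ hx,
    Finset.smul_sum]
  exact Finset.sum_congr rfl fun k _ => by rw [jet_smul _ _ hV k r hf hx, smul_comm]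

theorem pull_zero (Φ : STuple α' β' α β) (x : α → ℝ) : pull 0 Φ x = 0 := by
  have := pull_smul (Φ := Φ) (x := x) (f := 0) isOpen_univ contDiffOn_const 0 trivial
  rwa [zero_smul, zero_smul] at this

theorem pull_neg (hV : IsOpen V) (hf : ContDiffOn ℝ ∞ f V) (hx : bodyMap Φ x ∈ V) :
    pull (-f) Φ x = -pull f Φ x := by
  rw [← neg_one_smul ℝ f, pull_smul hV hf _ hx, neg_one_smul]

theorem pull_sum (hV : IsOpen V) {ι : Type*} (s : Finset ι) {F : ι → SFun α' β'}
    (hF : ∀ i ∈ s, ContDiffOn ℝ ∞ (F i) V) (hx : bodyMap Φ x ∈ V) :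
    pull (∑ i ∈ s, F i) Φ x = ∑ i ∈ s, pull (F i) Φ x := by
  classical
  induction s using Finset.induction_on with
  | empty => exact pull_zero Φ x
  | insert i s hi ih =>
    have hs : ContDiffOn ℝ ∞ (∑ j ∈ s, F j) V := by
      rw [Finset.sum_fn]
      exact ContDiffOn.sum fun j hj => hF j (Finset.mem_insert_of_mem hj)
    rw [Finset.sum_insert hi, Finset.sum_insert hi,
      pull_add hV (hF i (Finset.mem_insert_self i s)) hs hx,
      ih fun j hj => hF j (Finset.mem_insert_of_mem hj)]

theorem contDiffOn_mul {U : Set (α → ℝ)} {f g : SFun α β} (hU : IsOpen U)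
    (hf : ContDiffOn ℝ ∞ f U) (hg : ContDiffOn ℝ ∞ g U) : ContDiffOn ℝ ∞ (f * g) U :=
  fun _ hx => (contDiffAt_mul (hf.contDiffAt (hU.mem_nhds hx))
    (hg.contDiffAt (hU.mem_nhds hx))).contDiffWithinAt

theorem contDiffOn_involution {U : Set (α → ℝ)} {f : SFun α β} (hU : IsOpen U)
    (hf : ContDiffOn ℝ ∞ f U) : ContDiffOn ℝ ∞ (fun z => (f z).involution) U :=
  fun _ hx => (contDiffAt_linear involutionL (hf.contDiffAt (hU.mem_nhds hx))).contDiffWithinAt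

theorem contDiffOn_twist {U : Set (α → ℝ)} {f : SFun α β} (hU : IsOpen U)
    (hf : ContDiffOn ℝ ∞ f U) (s : ZMod 2) : ContDiffOn ℝ ∞ (fun z => twist s (f z)) U := by
  rcases zmod_two_cases s with rfl | rfl
  · exact hf
  · simpa only [twist_one] using contDiffOn_involution hU hf

theorem differentiableAt_of_contDiffOn {E : Type*} [NormedAddCommGroup E] [NormedSpace ℝ E]
    {U : Set (α → ℝ)} {f : (α → ℝ) → E} (hU : IsOpen U)
    (hf : ContDiffOn ℝ ∞ f U) {x : α → ℝ} (hx : x ∈ U) : DifferentiableAt ℝ f x :=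
  (hf.contDiffAt (hU.mem_nhds hx)).differentiableAt (by simp)

/-- Every other term contains an odd component or a soul, and these have no body. This is the base
case of all the inductions on order below. -/
theorem IsMapOn.pull_apply_empty (hΦ : IsMapOn Φ U V) (hV : IsOpen V)
    (hf : ContDiffOn ℝ ∞ f V) (hx : x ∈ U) : pull f Φ x ∅ = f (bodyMap Φ x) ∅ := by
  rw [pull_eq_sum_jet hV hf Φ (hΦ.mapsTo hx), Finset.sum_range_succ',
    Grassmann.add_apply, Grassmann.sum_apply, Finset.sum_eq_zero, zero_add, jet_zero,
    Grassmann.smul_apply, Grassmann.sum_apply, Finset.sum_eq_single ∅]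
  · simp [Grassmann.smul_apply, oddProd_empty, one_apply]
  · intro J _ hJ
    rw [Grassmann.smul_apply, oddProd_apply_empty fun b => hΦ.parity (.inr b) x hx,
      if_neg hJ, mul_zero]
  · simp
  · intro k _
    rw [Grassmann.smul_apply, jet_succ, Grassmann.sum_apply, Finset.sum_eq_zero, mul_zero]
    intro a _
    rw [mul_apply_empty, evenSoul, soul_apply_empty, zero_mul]

theorem IsMapOn.pd_pull (hΦ : IsMapOn Φ U V) (hU : IsOpen U) (hV : IsOpen V)
    (hf : ContDiffOn ℝ ∞ f V) (hx : x ∈ U) (c : α ⊕ β) :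
    pd c (pull f Φ) x = ∑ d, pd c (Φ d) x * pull (pd d f) Φ x :=
  (isPointDerivation_pd α' c x).pull hΦ hU hV hf hx

theorem IsMapOn.eulerL_pull (hΦ : IsMapOn Φ U V) (hU : IsOpen U) (hV : IsOpen V)
    (hf : ContDiffOn ℝ ∞ f V) (hx : x ∈ U) :
    eulerL (pull f Φ x) = ∑ d, eulerL (Φ d x) * pull (pd d f) Φ x :=
  (isPointDerivation_eulerL α' x).pull hΦ hU hV hf hx

/-- The defect is considered for all smooth `f` at once, since its Euler derivative involves the
defects of the partial derivatives of `f`. The sign from differentiating the involution matches the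
parity of `Φ d`. -/
theorem IsMapOn.pull_involution (hΦ : IsMapOn Φ U V) (hU : IsOpen U) (hV : IsOpen V)
    (hf : ContDiffOn ℝ ∞ f V) (hx : x ∈ U) :
    pull (fun z => (f z).involution) Φ x = (pull f Φ x).involution := by
  let u : {f : SFun α' β' // ContDiffOn ℝ ∞ f V} → Grassmann β := fun f =>
    pull (fun z => (f.1 z).involution) Φ x - (pull f.1 Φ x).involution
  refine sub_eq_zero.1 (eq_zero_of_eulerL u (fun f => ?_) (fun n hn f => ?_) ⟨f, hf⟩)
  · simp only [u, Grassmann.sub_apply, involution_apply, Finset.card_empty, pow_zero, one_mul,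
      hΦ.pull_apply_empty hV f.2 hx, hΦ.pull_apply_empty hV (contDiffOn_involution hV f.2) hx,
      sub_self]
  · obtain ⟨f, hf⟩ := f
    have e : eulerL (u ⟨f, hf⟩) = ∑ d, eulerL (Φ d x) *
        (parSign (coordParity d) • u ⟨pd d f, contDiffOn_pd hV hf d⟩) := by
      simp only [u, map_sub]
      rw [hΦ.eulerL_pull hU hV (contDiffOn_involution hV hf) hx, eulerL_involution,
        hΦ.eulerL_pull hU hV hf hx, involution_sum, ← Finset.sum_sub_distrib]
      refine Finset.sum_congr rfl fun d _ => ?_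
      rw [involution_mul, (hΦ.parity d x hx).eulerL.involution_eq, smul_mul_assoc,
        ← mul_smul_comm, ← mul_sub, smul_sub]
      congr 2
      have hc : Set.EqOn (pd d fun z => (f z).involution)
          (parSign (coordParity d) • fun z => (pd d f z).involution) V := fun z hz =>
        pd_involution (differentiableAt_of_contDiffOn hV hf hz) d
      rw [pull_congr hV (contDiffOn_pd hV (contDiffOn_involution hV hf) d) hc (hΦ.mapsTo hx),
        pull_smul hV (contDiffOn_involution hV (contDiffOn_pd hV hf d)) _ (hΦ.mapsTo hx)]
    rw [e]
    exact OrderGE.sum fun d _ => OrderGE.eulerL_mul _ ((hn _).smul _)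

theorem IsMapOn.pull_twist (hΦ : IsMapOn Φ U V) (hU : IsOpen U) (hV : IsOpen V)
    (hf : ContDiffOn ℝ ∞ f V) (hx : x ∈ U) (s : ZMod 2) :
    pull (fun z => twist s (f z)) Φ x = twist s (pull f Φ x) := by
  rcases zmod_two_cases s with rfl | rfl
  · rfl
  · simpa only [twist_one] using hΦ.pull_involution hU hV hf hx

theorem IsMapOn.hasParityOn_pull (hΦ : IsMapOn Φ U V) (hU : IsOpen U) (hV : IsOpen V)
    (hf : ContDiffOn ℝ ∞ f V) {s : ZMod 2} (h : HasParityOn s f V) :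
    HasParityOn s (pull f Φ) U := by
  intro x hx
  have hc : Set.EqOn (fun z => (f z).involution) (parSign s • f) V := fun z hz =>
    (h z hz).involution_eq
  rw [hasParity_iff, ← hΦ.pull_involution hU hV hf hx,
    pull_congr hV (contDiffOn_involution hV hf) hc (hΦ.mapsTo hx),
    pull_smul hV hf _ (hΦ.mapsTo hx)]

/-- The same induction over all pairs: by the product rule, the Euler derivative of the defect of
`(f, g)` involves those of `(∂f, g)` and of `(f, ∂g)` with `f` twisted. The twist is compensated by
moving `eulerL (Φ d x)` to the left of the pull-back of `f`, which is where parity preservation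
enters. -/
theorem IsMapOn.pull_mul (hΦ : IsMapOn Φ U V) (hU : IsOpen U) (hV : IsOpen V)
    (hf : ContDiffOn ℝ ∞ f V) (hg : ContDiffOn ℝ ∞ g V) (hx : x ∈ U) :
    pull (f * g) Φ x = pull f Φ x * pull g Φ x := by
  let S := {f : SFun α' β' // ContDiffOn ℝ ∞ f V}
  let u : S × S → Grassmann β := fun p =>
    pull (p.1.1 * p.2.1) Φ x - pull p.1.1 Φ x * pull p.2.1 Φ x
  refine sub_eq_zero.1
    (eq_zero_of_eulerL u (fun p => ?_) (fun n hn p => ?_) (⟨f, hf⟩, ⟨g, hg⟩))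
  · simp only [u, Grassmann.sub_apply, mul_apply_empty, hΦ.pull_apply_empty hV p.1.2 hx,
      hΦ.pull_apply_empty hV p.2.2 hx,
      hΦ.pull_apply_empty hV (contDiffOn_mul hV p.1.2 p.2.2) hx, Pi.mul_apply, sub_self]
  · obtain ⟨⟨f, hf⟩, ⟨g, hg⟩⟩ := p
    have e : eulerL (u (⟨f, hf⟩, ⟨g, hg⟩)) = ∑ d, eulerL (Φ d x) *
        (u (⟨pd d f, contDiffOn_pd hV hf d⟩, ⟨g, hg⟩) +
          u (⟨fun z => twist (coordParity d) (f z), contDiffOn_twist hV hf _⟩,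
            ⟨pd d g, contDiffOn_pd hV hg d⟩)) := by
      simp only [u, map_sub]
      rw [hΦ.eulerL_pull hU hV (contDiffOn_mul hV hf hg) hx, Grassmann.eulerL_mul,
        hΦ.eulerL_pull hU hV hf hx, hΦ.eulerL_pull hU hV hg hx, Finset.sum_mul, Finset.mul_sum,
        ← Finset.sum_add_distrib, ← Finset.sum_sub_distrib]
      refine Finset.sum_congr rfl fun d _ => ?_
      have hc : Set.EqOn (pd d (f * g))
          (pd d f * g + (fun z => twist (coordParity d) (f z)) * pd d g) V := fun z hz =>
        pd_mul (differentiableAt_of_contDiffOn hV hf hz)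
          (differentiableAt_of_contDiffOn hV hg hz) d
      rw [pull_congr hV (contDiffOn_pd hV (contDiffOn_mul hV hf hg) d) hc (hΦ.mapsTo hx),
        pull_add hV (contDiffOn_mul hV (contDiffOn_pd hV hf d) hg)
          (contDiffOn_mul hV (contDiffOn_twist hV hf _) (contDiffOn_pd hV hg d)) (hΦ.mapsTo hx),
        hΦ.pull_twist hU hV hf hx, ← mul_assoc (pull f Φ x),
        (hΦ.parity d x hx).eulerL.mul_eq_mul_twist (pull f Φ x)]
      noncomm_ring
    rw [e]
    exact OrderGE.sum fun d _ => OrderGE.eulerL_mul _ ((hn _).add (hn _))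

theorem contDiffOn_one {V : Set (α → ℝ)} : ContDiffOn ℝ ∞ (1 : SFun α β) V := contDiffOn_const

theorem pd_one (c : α ⊕ β) (x : α → ℝ) : pd c (1 : SFun α β) x = 0 := by
  cases c with
  | inl a =>
    have : fderiv ℝ (1 : SFun α β) x = 0 := fderiv_const_apply _
    rw [pd_inl_apply, this]
    rfl
  | inr b => exact leftDeriv_one b

theorem eq_of_eulerL_eq {u v : Grassmann β} (h : eulerL u = eulerL v) (h0 : u ∅ = v ∅) : u = v := by
  refine sub_eq_zero.1 (OrderGE.eq_zero (n := Fintype.card β + 1) (OrderGE.of_eulerL ?_ ?_)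
    (Nat.lt_succ_self _))
  · rw [map_sub, h, sub_self]
    exact fun _ _ => rfl
  · rw [Grassmann.sub_apply, h0, sub_self]

theorem IsMapOn.pull_one (hΦ : IsMapOn Φ U V) (hU : IsOpen U) (hV : IsOpen V) (hx : x ∈ U) :
    pull 1 Φ x = 1 := by
  refine eq_of_eulerL_eq ?_ ?_
  · rw [hΦ.eulerL_pull hU hV contDiffOn_one hx, eulerL_one]
    refine Finset.sum_eq_zero fun d _ => ?_
    rw [show pd d (1 : SFun α' β') = 0 from funext (pd_one d), pull_zero, mul_zero]
  · rw [hΦ.pull_apply_empty hV contDiffOn_one hx]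
    simp [one_apply]

theorem IsMapOn.pull_coord (hΦ : IsMapOn Φ U V) (hU : IsOpen U) (hV : IsOpen V) (hx : x ∈ U)
    (c : α' ⊕ β') : pull (coord c) Φ x = Φ c x := by
  refine eq_of_eulerL_eq ?_ ?_
  · rw [hΦ.eulerL_pull hU hV (contDiff_coord c).contDiffOn hx, Finset.sum_eq_single c]
    · rw [show pd c (coord c : SFun α' β') = 1 from funext fun z => by simp [pd_coord],
        hΦ.pull_one hU hV hx, mul_one]
    · intro d _ hd
      rw [show pd d (coord c : SFun α' β') = 0 from funext fun z => by simp [pd_coord, hd],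
        pull_zero, mul_zero]
    · simp
  · rw [hΦ.pull_apply_empty hV (contDiff_coord c).contDiffOn hx]
    cases c with
    | inl a => simp [coord, Grassmann.smul_apply, one_apply, bodyMap, body]
    | inr b => rw [(hΦ.parity (.inr b) x hx).apply_empty]; exact (hasParity_gen b).apply_empty

theorem bodyMap_coord (x : α → ℝ) : bodyMap (coord : STuple α β α β) x = x := by
  funext a
  simp [bodyMap, coord, body, Grassmann.smul_apply, one_apply]

theorem isMapOn_coord (V : Set (α → ℝ)) : IsMapOn (coord : STuple α β α β) V V where
  smooth c := (contDiff_coord c).contDiffOn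
  parity c x _ := hasParity_coord c x
  mapsTo x hx := by rwa [bodyMap_coord]

/-- For the identity map only the odd coordinates have a nonzero Euler derivative, so the chain rule
for `pull f coord` has the same shape as the expansion of the Euler operator on `f x` itself. -/
theorem pull_coord_right {V : Set (α → ℝ)} (hV : IsOpen V) {f : SFun α β}
    (hf : ContDiffOn ℝ ∞ f V) {x : α → ℝ} (hx : x ∈ V) : pull f coord x = f x := by
  let u : {f : SFun α β // ContDiffOn ℝ ∞ f V} → Grassmann β := fun f =>
    pull f.1 coord x - f.1 x
  refine sub_eq_zero.1 (eq_zero_of_eulerL u (fun f => ?_) (fun n hn f => ?_) ⟨f, hf⟩)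
  · simp only [u, Grassmann.sub_apply, (isMapOn_coord V).pull_apply_empty hV f.2 hx,
      bodyMap_coord, sub_self]
  · obtain ⟨f, hf⟩ := f
    have e : eulerL (u ⟨f, hf⟩) = ∑ b, eulerL (gen b) *
        u ⟨pd (.inr b) f, contDiffOn_pd hV hf (.inr b)⟩ := by
      simp only [u, map_sub]
      rw [(isMapOn_coord V).eulerL_pull hV hV hf hx, ← eulerL_gen_mul_leftDeriv (f x),
        Fintype.sum_sum_type]
      simp only [coord, map_smul, eulerL_one, smul_zero, zero_mul, Finset.sum_const_zero, zero_add,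
        eulerL_gen, mul_sub, Finset.sum_sub_distrib, pd_inr_apply]
    rw [e]
    exact OrderGE.sum fun d _ => OrderGE.eulerL_mul _ (hn _)

end Pull

/-! ### Functoriality of the pull-back -/

section Comp

variable {α'' β'' : Type*} [Fintype α''] [DecidableEq α''] [Fintype β''] [LinearOrder β'']
  {U : Set (α → ℝ)} {V : Set (α' → ℝ)} {X : Set (α'' → ℝ)} {Ψ : STuple α' β' α β}
  {Φ : STuple α'' β'' α' β'}

theorem IsMapOn.bodyMap_comp (hΨ : IsMapOn Ψ U V) (hΦ : IsMapOn Φ V X) (hV : IsOpen V)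
    {x : α → ℝ} (hx : x ∈ U) :
    bodyMap (fun c => pull (Φ c) Ψ) x = bodyMap Φ (bodyMap Ψ x) :=
  funext fun a => hΨ.pull_apply_empty hV (hΦ.smooth (.inl a)) hx

theorem IsMapOn.comp (hΨ : IsMapOn Ψ U V) (hΦ : IsMapOn Φ V X) (hU : IsOpen U)
    (hV : IsOpen V) : IsMapOn (fun c => pull (Φ c) Ψ) U X where
  smooth c := hΨ.contDiffOn_pull hU hV (hΦ.smooth c)
  parity c := hΨ.hasParityOn_pull hU hV (hΦ.smooth c) (hΦ.parity c)
  mapsTo x hx := by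
    rw [hΨ.bodyMap_comp hΦ hV hx]
    exact hΦ.mapsTo (hΨ.mapsTo hx)

/-- Both sides obey the same recursion: on the left the chain rule is used for `Ψ` and then for `Φ`,
on the right for the composite, whose Euler derivatives are again expanded through `Ψ`. -/
theorem IsMapOn.pull_pull (hΨ : IsMapOn Ψ U V) (hΦ : IsMapOn Φ V X) (hU : IsOpen U)
    (hV : IsOpen V) (hX : IsOpen X) {f : SFun α'' β''} (hf : ContDiffOn ℝ ∞ f X)
    {x : α → ℝ} (hx : x ∈ U) :
    pull (pull f Φ) Ψ x = pull f (fun c => pull (Φ c) Ψ) x := by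
  let u : {f : SFun α'' β'' // ContDiffOn ℝ ∞ f X} → Grassmann β := fun f =>
    pull (pull f.1 Φ) Ψ x - pull f.1 (fun c => pull (Φ c) Ψ) x
  have hcomp := hΨ.comp hΦ hU hV
  refine sub_eq_zero.1 (eq_zero_of_eulerL u (fun f => ?_) (fun n hn f => ?_) ⟨f, hf⟩)
  · simp only [u, Grassmann.sub_apply]
    rw [hcomp.pull_apply_empty hX f.2 hx,
      hΨ.pull_apply_empty hV (hΦ.contDiffOn_pull hV hX f.2) hx,
      hΦ.pull_apply_empty hX f.2 (hΨ.mapsTo hx), hΨ.bodyMap_comp hΦ hV hx, sub_self]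
  · obtain ⟨f, hf⟩ := f
    have hfd := contDiffOn_pd hX hf
    have hΦd := fun c d => contDiffOn_pd hV (hΦ.smooth d) c
    have hp := fun d => hΦ.contDiffOn_pull hV hX (hfd d)
    have e : eulerL (u ⟨f, hf⟩) = ∑ d, eulerL (pull (Φ d) Ψ x) *
        u ⟨pd d f, contDiffOn_pd hX hf d⟩ := by
      simp only [u, map_sub]
      rw [hΨ.eulerL_pull hU hV (hΦ.contDiffOn_pull hV hX hf) hx, hcomp.eulerL_pull hU hX hf hx]
      simp only [mul_sub, Finset.sum_sub_distrib]
      congr 1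
      simp only [hΨ.eulerL_pull hU hV (hΦ.smooth _) hx, Finset.sum_mul]
      rw [Finset.sum_comm]
      refine Finset.sum_congr rfl fun c _ => ?_
      have hc : Set.EqOn (pd c (pull f Φ)) (∑ d, pd c (Φ d) * pull (pd d f) Φ) V := fun z hz => by
        rw [hΦ.pd_pull hV hX hf hz, Finset.sum_apply]
        rfl
      rw [pull_congr hV (contDiffOn_pd hV (hΦ.contDiffOn_pull hV hX hf) c) hc (hΨ.mapsTo hx),
        pull_sum hV _ (fun d _ => contDiffOn_mul hV (hΦd c d) (hp d)) (hΨ.mapsTo hx),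
        Finset.mul_sum]
      refine Finset.sum_congr rfl fun d _ => ?_
      rw [hΨ.pull_mul hU hV (hΦd c d) (hp d) hx, mul_assoc]
    rw [e]
    exact OrderGE.sum fun d _ => OrderGE.eulerL_mul _ (hn _)

end Comp

end SFun

namespace SFun

variable {α β : Type*} [Fintype α] [DecidableEq α] [Fintype β] [LinearOrder β]

theorem pd_coord_self (c : α ⊕ β) (x : α → ℝ) : pd c (coord c) x = 1 := by
  rw [pd_coord, if_pos rfl]

theorem pd_coord_of_ne {c d : α ⊕ β} (h : c ≠ d) (x : α → ℝ) : pd c (coord d) x = 0 := by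
  rw [pd_coord, if_neg h]

theorem sum_pd_coord_mul (c : α ⊕ β) (x : α → ℝ) (u : α ⊕ β → Grassmann β) :
    ∑ e, pd c (coord e) x * u e = u c := by
  rw [Finset.sum_eq_single c, pd_coord_self, one_mul]
  · intro e _ he
    rw [pd_coord_of_ne he.symm, zero_mul]
  · exact fun h => (h (Finset.mem_univ c)).elim

theorem contDiffOn_coord (c : α ⊕ β) (U : Set (α → ℝ)) :
    ContDiffOn ℝ ∞ (coord c : SFun α β) U := (contDiff_coord c).contDiffOn

theorem contDiffOn_sum {ι : Type*} (s : Finset ι) {F : ι → SFun α β} {U : Set (α → ℝ)}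
    (hF : ∀ i ∈ s, ContDiffOn ℝ ∞ (F i) U) : ContDiffOn ℝ ∞ (∑ i ∈ s, F i) U := by
  rw [Finset.sum_fn]
  exact ContDiffOn.sum hF

theorem pd_sum {ι : Type*} (s : Finset ι) {F : ι → SFun α β} {x : α → ℝ}
    (hF : ∀ i ∈ s, DifferentiableAt ℝ (F i) x) (c : α ⊕ β) :
    pd c (∑ i ∈ s, F i) x = ∑ i ∈ s, pd c (F i) x :=
  (isPointDerivation_pd α c x).sum s hF

theorem pd_sub {f g : SFun α β} {x : α → ℝ} (hf : DifferentiableAt ℝ f x)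
    (hg : DifferentiableAt ℝ g x) (c : α ⊕ β) : pd c (f - g) x = pd c f x - pd c g x := by
  rw [sub_eq_add_neg, ← neg_one_smul ℝ g, pd_add hf (hg.const_smul _), pd_smul hg, neg_one_smul,
    sub_eq_add_neg]

theorem rpd_of_even {f : SFun α β} {x : α → ℝ} (h : (f x).HasParity 0) (c : α ⊕ β) :
    rpd c f x = parSign (coordParity c) • pd c f x := by
  cases c with
  | inl a => exact (one_smul _ _).symm
  | inr b =>
    have : (f x).involution.leftDeriv b = (f x).leftDeriv b := by
      rw [hasParity_zero_iff.1 h]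
    rw [show coordParity (Sum.inr b : α ⊕ β) = 1 from rfl, parSign_one, neg_one_smul,
      pd_inr_apply, ← this]
    rfl

theorem IsMapOn.mono {α' β' : Type*} {U U' : Set (α → ℝ)} {V V' : Set (α' → ℝ)}
    {Φ : STuple α' β' α β} (hΦ : IsMapOn Φ U V) (hU : U' ⊆ U)
    (h : Set.MapsTo (bodyMap Φ) U' V') : IsMapOn Φ U' V' where
  smooth c := (hΦ.smooth c).mono hU
  parity c x hx := hΦ.parity c x (hU hx)
  mapsTo := h

end SFun

/-! ### The Legendre transform in one chart -/

section Local

variable {p q : ℕ}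

@[simp] theorem tuple_baseIdx (B F : Fin p ⊕ Fin q → TFun p q) (a : Fin p ⊕ Fin q) :
    tuple B F (baseIdx a) = B a := by cases a <;> rfl

@[simp] theorem tuple_fibIdx (B F : Fin p ⊕ Fin q → TFun p q) (a : Fin p ⊕ Fin q) :
    tuple B F (fibIdx a) = F a := by cases a <;> rfl

theorem coordParity_baseIdx (a : Fin p ⊕ Fin q) :
    coordParity (baseIdx a) = coordParity a := by cases a <;> rfl

theorem coordParity_fibIdx (a : Fin p ⊕ Fin q) :
    coordParity (fibIdx a) = coordParity a + 1 := by cases a <;> rfl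

theorem paritySign_eq_parSign (a : Fin p ⊕ Fin q) :
    paritySign a = parSign (coordParity a) := by
  cases a
  · rfl
  · exact parSign_one.symm

theorem parSign_fibIdx (a : Fin p ⊕ Fin q) :
    parSign (coordParity (fibIdx a)) = -paritySign a := by
  rw [coordParity_fibIdx, parSign_add, parSign_one, paritySign_eq_parSign, mul_neg_one]

theorem eq_baseIdx_or_fibIdx (c : TIdx p q) : (∃ a, c = baseIdx a) ∨ ∃ a, c = fibIdx a := by
  rcases c with (i | j) | l
  · exact .inl ⟨.inl i, rfl⟩
  · exact .inr ⟨.inr j, rfl⟩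
  · rcases l with j | i
    · exact .inl ⟨.inr j, rfl⟩
    · exact .inr ⟨.inl i, rfl⟩

theorem fibIdx_ne_baseIdx (a b : Fin p ⊕ Fin q) : fibIdx a ≠ baseIdx b := by
  cases a <;> cases b <;> rintro ⟨⟩

theorem fibIdx_injective : Function.Injective (fibIdx : Fin p ⊕ Fin q → TIdx p q) := by
  rintro (a | a) (b | b) h <;> cases h <;> rfl

theorem sum_tIdx {E : Type*} [AddCommMonoid E] (g : TIdx p q → E) :
    ∑ c, g c = ∑ a, g (baseIdx a) + ∑ a, g (fibIdx a) := by
  have h : ∑ l : Fin q ⊕ₗ Fin p, g (.inr l) = ∑ l : Fin q ⊕ Fin p, g (.inr (toLex l)) :=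
    (Fintype.sum_equiv toLex _ _ fun _ => rfl).symm
  rw [Fintype.sum_sum_type, h, Fintype.sum_sum_type, Fintype.sum_sum_type, Fintype.sum_sum_type,
    Fintype.sum_sum_type]
  simp only [baseIdx, fibIdx]
  abel

theorem phi_baseIdx (P : TFun p q) (a : Fin p ⊕ Fin q) :
    phi P (baseIdx a) = coord (baseIdx a) := tuple_baseIdx _ _ a

theorem phi_fibIdx (P : TFun p q) (a : Fin p ⊕ Fin q) :
    phi P (fibIdx a) = -paritySign a • pd (fibIdx a) P := tuple_fibIdx _ _ a

variable {W V : Set (Fin p ⊕ Fin q → ℝ)} {P : TFun p q} {ψ : TTuple p q}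

theorem contDiffOn_eulerSub (hW : IsOpen W) (hP : ContDiffOn ℝ ∞ P W) :
    ContDiffOn ℝ ∞ (eulerSub P) W := by
  refine ContDiffOn.sub (contDiffOn_sum _ fun a _ => ?_) hP
  exact contDiffOn_mul hW (contDiffOn_coord _ _) (contDiffOn_pd hW hP _)

theorem hasParityOn_eulerSub (hW : IsOpen W) (hP : ContDiffOn ℝ ∞ P W)
    (hP0 : HasParityOn 0 P W) : HasParityOn 0 (eulerSub P) W := by
  intro x hx
  refine HasParity.sub ?_ (hP0 x hx)
  rw [Finset.sum_apply]
  refine HasParity.sum fun a _ => ?_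
  have := (hasParity_coord (fibIdx a) x).mul (hasParityOn_pd hW hP hP0 (fibIdx a) x hx)
  rwa [zero_add, CharTwo.add_self_eq_zero] at this

/-- The tuple of the `φ_P`-pull-backs of the partial derivatives of the Legendre transform. -/
noncomputable def legendreGrad (P : TFun p q) : TTuple p q :=
  tuple (fun a => -pd (baseIdx a) P) fun a => coord (fibIdx a)

theorem contDiffOn_neg {U : Set (Fin p ⊕ Fin q → ℝ)} {f : TFun p q} (hf : ContDiffOn ℝ ∞ f U) :
    ContDiffOn ℝ ∞ (-f) U := hf.neg

theorem contDiffOn_legendreGrad (hW : IsOpen W) (hP : ContDiffOn ℝ ∞ P W) (c : TIdx p q) :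
    ContDiffOn ℝ ∞ (legendreGrad P c) W := by
  rcases eq_baseIdx_or_fibIdx c with ⟨a, rfl⟩ | ⟨a, rfl⟩
  · rw [legendreGrad, tuple_baseIdx]
    exact contDiffOn_neg (contDiffOn_pd hW hP _)
  · rw [legendreGrad, tuple_fibIdx]
    exact contDiffOn_coord _ _

theorem contDiffOn_phi (hW : IsOpen W) (hP : ContDiffOn ℝ ∞ P W) (c : TIdx p q) :
    ContDiffOn ℝ ∞ (phi P c) W := by
  rcases eq_baseIdx_or_fibIdx c with ⟨a, rfl⟩ | ⟨a, rfl⟩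
  · rw [phi_baseIdx]
    exact contDiffOn_coord _ _
  · rw [phi_fibIdx]
    exact contDiffOn_smul _ (contDiffOn_pd hW hP _)

/-- The terms `∂_c x*ₐ · ∂P/∂x*ₐ` cancel against the fibre part of `∂_c P`. In the remaining ones
`x*ₐ` is moved to the right of the second derivative of `P`; the resulting sign `-(-1) ^ ã` is the
one built into `phi`. -/
theorem pd_eulerSub (hW : IsOpen W) (hP : ContDiffOn ℝ ∞ P W) (hP0 : HasParityOn 0 P W)
    {x : Fin p ⊕ Fin q → ℝ} (hx : x ∈ W) (c : TIdx p q) :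
    pd c (eulerSub P) x = ∑ e, pd c (phi P e) x * legendreGrad P e x := by
  have hdP := differentiableAt_of_contDiffOn hW hP hx
  have hd := fun a => differentiableAt_of_contDiffOn hW (contDiffOn_pd hW hP a) hx
  have hdc : ∀ a : TIdx p q, DifferentiableAt ℝ (coord a : TFun p q) x := fun a =>
    differentiableAt_of_contDiffOn hW (contDiffOn_coord a W) hx
  have hm := fun a => differentiableAt_of_contDiffOn hW
    (contDiffOn_mul hW (contDiffOn_coord (fibIdx a) W) (contDiffOn_pd hW hP (fibIdx a))) hx
  have hs := differentiableAt_of_contDiffOn hW (contDiffOn_sum Finset.univ fun a _ =>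
    contDiffOn_mul hW (contDiffOn_coord (fibIdx a) W) (contDiffOn_pd hW hP (fibIdx a))) hx
  rw [eulerSub, pd_sub hs hdP, pd_sum _ fun a _ => hm a,
    ← sum_pd_coord_mul c x fun e => pd e P x, sum_tIdx, sum_tIdx]
  have h1 : ∀ a, pd c (coord (fibIdx a) * pd (fibIdx a) P) x =
      pd c (coord (fibIdx a)) x * pd (fibIdx a) P x +
        pd c (phi P (fibIdx a)) x * legendreGrad P (fibIdx a) x := by
    intro a
    rw [pd_mul (hdc _) (hd _), phi_fibIdx, legendreGrad, tuple_fibIdx, pd_smul (hd _)]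
    have h2 := hasParityOn_pd hW (contDiffOn_pd hW hP (fibIdx a))
      (hasParityOn_pd hW hP hP0 (fibIdx a)) c x hx
    rw [zero_add] at h2
    rw [(hasParity_coord (fibIdx a) x).twist_mul h2, parSign_fibIdx, smul_mul_assoc]
  have h2 : ∀ a, pd c (phi P (baseIdx a)) x * legendreGrad P (baseIdx a) x =
      -(pd c (coord (baseIdx a)) x * pd (baseIdx a) P x) := by
    intro a
    rw [phi_baseIdx, legendreGrad, tuple_baseIdx, Pi.neg_apply, mul_neg]
  simp only [h1, h2, Finset.sum_add_distrib, Finset.sum_neg_distrib]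
  abel

/-- The chain rule produces the Jacobian of `ψ` times the pulled-back Jacobian of `φ_P`, which is
the Jacobian of `φ_P ∘ ψ = id`. So no derivative of `ψ` survives. -/
theorem pd_pull_eulerSub (hW : IsOpen W) (hV : IsOpen V) (hP : ContDiffOn ℝ ∞ P W)
    (hP0 : HasParityOn 0 P W) (hψ : IsInverseOn (phi P) ψ W V)
    {z : Fin p ⊕ Fin q → ℝ} (hz : z ∈ V) (d : TIdx p q) :
    pd d (pull (eulerSub P) ψ) z = pull (legendreGrad P d) ψ z := by
  have hE := contDiffOn_eulerSub hW hP
  have hφ := fun c e => contDiffOn_pd hW (contDiffOn_phi hW hP e) c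
  have hw := contDiffOn_legendreGrad hW hP
  have hψz := hψ.inv.mapsTo hz
  have h1 : ∀ c, pull (pd c (eulerSub P)) ψ z =
      ∑ e, pull (pd c (phi P e)) ψ z * pull (legendreGrad P e) ψ z := by
    intro c
    have hc : Set.EqOn (pd c (eulerSub P)) (∑ e, pd c (phi P e) * legendreGrad P e) W :=
      fun x hx => by rw [pd_eulerSub hW hP hP0 hx, Finset.sum_apply]; rfl
    rw [pull_congr hW (contDiffOn_pd hW hE c) hc hψz,
      pull_sum hW _ (fun e _ => contDiffOn_mul hW (hφ c e) (hw e)) hψz]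
    exact Finset.sum_congr rfl fun e _ => hψ.inv.pull_mul hV hW (hφ c e) (hw e) hz
  rw [hψ.inv.pd_pull hV hW hE hz, ← sum_pd_coord_mul d z fun e => pull (legendreGrad P e) ψ z]
  simp only [h1, Finset.mul_sum, ← mul_assoc]
  rw [Finset.sum_comm]
  refine Finset.sum_congr rfl fun e _ => ?_
  rw [← Finset.sum_mul, ← hψ.inv.pd_pull hV hW (contDiffOn_phi hW hP e) hz,
    pd_congr hV (hψ.right_inv e) d hz]

/-- For even `P`, the derivatives along `xᵃ` and `x*ₐ` have opposite parities, so one of them is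
even and they commute. The right derivatives contribute opposite signs, and the two halves of the
bracket add up. -/
theorem schouten_self (hW : IsOpen W) (hP : ContDiffOn ℝ ∞ P W) (hP0 : HasParityOn 0 P W)
    {x : Fin p ⊕ Fin q → ℝ} (hx : x ∈ W) :
    (-(1 / 2 : ℝ)) • schouten P P x = ∑ a, phi P (fibIdx a) x * legendreGrad P (baseIdx a) x := by
  rw [schouten, Finset.sum_apply, Finset.smul_sum]
  refine Finset.sum_congr rfl fun a _ => ?_
  have hb := hasParityOn_pd hW hP hP0 (baseIdx a) x hx
  have hf := hasParityOn_pd hW hP hP0 (fibIdx a) x hx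
  have hcomm : pd (baseIdx a) P x * pd (fibIdx a) P x =
      pd (fibIdx a) P x * pd (baseIdx a) P x := by
    rw [hb.mul_swap hf, zero_add, zero_add, coordParity_baseIdx, coordParity_fibIdx]
    rw [show coordParity a * (coordParity a + 1) = 0 from by
      generalize coordParity a = s; revert s; decide, parSign_zero, one_smul]
  rw [phi_fibIdx, legendreGrad, tuple_baseIdx, Pi.sub_apply, Pi.mul_apply, Pi.mul_apply,
    rpd_of_even (hP0 x hx), rpd_of_even (hP0 x hx), parSign_fibIdx, coordParity_baseIdx,
    ← paritySign_eq_parSign, smul_mul_assoc, smul_mul_assoc, hcomm, Pi.smul_apply, Pi.neg_apply,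
    smul_mul_assoc, mul_neg]
  module

theorem contDiffOn_rpd {U : Set (Fin p ⊕ Fin q → ℝ)} (hU : IsOpen U) {f : TFun p q}
    (hf : ContDiffOn ℝ ∞ f U) (c : TIdx p q) : ContDiffOn ℝ ∞ (rpd c f) U := by
  cases c with
  | inl a => exact contDiffOn_pd hU hf (.inl a)
  | inr b => exact contDiffOn_neg (contDiffOn_pd hU (contDiffOn_involution hU hf) _)

theorem contDiffOn_schouten (hW : IsOpen W) (hP : ContDiffOn ℝ ∞ P W) :
    ContDiffOn ℝ ∞ (schouten P P) W := by
  refine contDiffOn_sum _ fun a _ => ContDiffOn.sub ?_ ?_ <;>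
    exact contDiffOn_mul hW (contDiffOn_rpd hW hP _) (contDiffOn_pd hW hP _)

theorem extDiff_pull_eulerSub (hW : IsOpen W) (hV : IsOpen V) (hP : ContDiffOn ℝ ∞ P W)
    (hP0 : HasParityOn 0 P W) (hψ : IsInverseOn (phi P) ψ W V) :
    Set.EqOn (extDiff (pull (eulerSub P) ψ)) (-(1 / 2 : ℝ) • pull (schouten P P) ψ) V := by
  intro z hz
  have hψz := hψ.inv.mapsTo hz
  have hw := contDiffOn_legendreGrad hW hP
  have hφ := contDiffOn_phi hW hP
  have hc : Set.EqOn (-(1 / 2 : ℝ) • schouten P P)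
      (∑ a, phi P (fibIdx a) * legendreGrad P (baseIdx a)) W := fun x hx => by
    rw [Finset.sum_apply]
    exact schouten_self hW hP hP0 hx
  rw [Pi.smul_apply, ← pull_smul hW (contDiffOn_schouten hW hP) _ hψz,
    pull_congr hW (contDiffOn_smul _ (contDiffOn_schouten hW hP)) hc hψz,
    pull_sum hW _ (fun a _ => contDiffOn_mul hW (hφ _) (hw _)) hψz, extDiff, Finset.sum_apply]
  refine Finset.sum_congr rfl fun a _ => ?_
  rw [hψ.inv.pull_mul hV hW (hφ _) (hw _) hz, hψ.right_inv _ hz, Pi.mul_apply,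
    pd_pull_eulerSub hW hV hP hP0 hψ hz]

theorem IsInverseOn.pull_pull_of_map {Φ Ψ : TTuple p q} (h : IsInverseOn Φ Ψ W V)
    (hW : IsOpen W) (hV : IsOpen V) {f : TFun p q} (hf : ContDiffOn ℝ ∞ f W)
    {x : Fin p ⊕ Fin q → ℝ} (hx : x ∈ W) : pull (pull f Ψ) Φ x = f x := by
  rw [h.map.pull_pull h.inv hW hV hW hf hx, pull_congr_right f fun c => h.left_inv c hx,
    pull_coord_right hW hf hx]

theorem schouten_eq_zero_iff (hW : IsOpen W) (hV : IsOpen V) (hP : ContDiffOn ℝ ∞ P W)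
    (hP0 : HasParityOn 0 P W) (hψ : IsInverseOn (phi P) ψ W V) :
    Set.EqOn (schouten P P) 0 W ↔ Set.EqOn (extDiff (pull (eulerSub P) ψ)) 0 V := by
  have hS := contDiffOn_schouten hW hP
  have hd := extDiff_pull_eulerSub hW hV hP hP0 hψ
  refine ⟨fun h z hz => ?_, fun h x hx => ?_⟩
  · rw [hd hz, Pi.smul_apply, pull_congr hW hS h (hψ.inv.mapsTo hz), pull_zero, smul_zero]
    rfl
  · have h0 : Set.EqOn (pull (schouten P P) ψ) 0 V := fun z hz => by
      have := (hd hz).symm.trans (h hz)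
      rw [Pi.smul_apply] at this
      exact (smul_eq_zero.1 this).resolve_left (by norm_num)
    rw [← IsInverseOn.pull_pull_of_map hψ hW hV hS hx,
      pull_congr hV (hψ.inv.contDiffOn_pull hV hW hS) h0 (hψ.map.mapsTo hx), pull_zero]
    rfl

end Local

/-! ### Functions lifted from the base to the total space -/

section Lift

variable {p q : ℕ} {S : Set (Fin p → ℝ)} {f g : SFun (Fin p) (Fin q)}
  {z : Fin p ⊕ Fin q → ℝ}

/-- The projection of the total space to the base, on bodies. -/
def bodyProj (z : Fin p ⊕ Fin q → ℝ) : Fin p → ℝ := fun k => z (.inl k)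

/-- The projection of the total space to the base. -/
noncomputable def baseProj : STuple (Fin p) (Fin q) (Fin p ⊕ Fin q) (Fin q ⊕ₗ Fin p) :=
  fun a => coord (baseIdx a)

theorem continuous_bodyProj : Continuous (bodyProj : (Fin p ⊕ Fin q → ℝ) → Fin p → ℝ) :=
  continuous_pi fun _ => continuous_apply _

theorem bodyMap_baseProj (z : Fin p ⊕ Fin q → ℝ) : bodyMap baseProj z = bodyProj z := by
  funext a
  exact congrFun (bodyMap_coord (β := Fin q ⊕ₗ Fin p) z) (.inl a)

theorem isMapOn_baseProj (S : Set (Fin p → ℝ)) :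
    IsMapOn (baseProj (p := p) (q := q)) (bodyProj ⁻¹' S) S where
  smooth c := contDiffOn_coord _ _
  parity c z _ := coordParity_baseIdx c ▸ hasParity_coord (baseIdx c) z
  mapsTo z hz := by rwa [bodyMap_baseProj]

theorem isOpen_preimage_bodyProj (hS : IsOpen S) :
    IsOpen (bodyProj ⁻¹' S : Set (Fin p ⊕ Fin q → ℝ)) := hS.preimage continuous_bodyProj

theorem contDiffOn_lift (hS : IsOpen S) (hf : ContDiffOn ℝ ∞ f S) :
    ContDiffOn ℝ ∞ (lift f) (bodyProj ⁻¹' S) :=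
  (isMapOn_baseProj S).contDiffOn_pull (isOpen_preimage_bodyProj hS) hS hf

theorem hasParityOn_lift (hS : IsOpen S) (hf : ContDiffOn ℝ ∞ f S) {s : ZMod 2}
    (h : HasParityOn s f S) : HasParityOn s (lift f) (bodyProj ⁻¹' S) :=
  (isMapOn_baseProj S).hasParityOn_pull (isOpen_preimage_bodyProj hS) hS hf h

theorem lift_apply_empty (hS : IsOpen S) (hf : ContDiffOn ℝ ∞ f S) (hz : bodyProj z ∈ S) :
    lift f z ∅ = f (bodyProj z) ∅ := by
  rw [← bodyMap_baseProj]
  exact (isMapOn_baseProj S).pull_apply_empty hS hf hz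

theorem pd_fibIdx_lift (hS : IsOpen S) (hf : ContDiffOn ℝ ∞ f S) (hz : bodyProj z ∈ S)
    (a : Fin p ⊕ Fin q) : pd (fibIdx a) (lift f) z = 0 := by
  refine ((isMapOn_baseProj S).pd_pull (isOpen_preimage_bodyProj hS) hS hf hz _).trans ?_
  refine Finset.sum_eq_zero fun d _ => ?_
  rw [baseProj, pd_coord_of_ne (fibIdx_ne_baseIdx a d), zero_mul]

theorem pull_lift {α β : Type*} [Fintype α] [DecidableEq α] [Fintype β] [LinearOrder β]
    {U : Set (α → ℝ)} {Φ : STuple (Fin p ⊕ Fin q) (Fin q ⊕ₗ Fin p) α β} (hU : IsOpen U)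
    (hS : IsOpen S) (hΦ : IsMapOn Φ U (bodyProj ⁻¹' S)) (hf : ContDiffOn ℝ ∞ f S)
    {x : α → ℝ} (hx : x ∈ U) :
    pull (lift f) Φ x = pull f (fun a => Φ (baseIdx a)) x := by
  refine (hΦ.pull_pull (isMapOn_baseProj S) hU (isOpen_preimage_bodyProj hS) hS hf hx).trans ?_
  exact pull_congr_right f fun c => hΦ.pull_coord hU (isOpen_preimage_bodyProj hS) hx _

end Lift

/-! ### Change of charts and gluing -/

namespace SuperAtlas

variable {p q : ℕ} {M : Type*} [TopologicalSpace M] (A : SuperAtlas p q M) (i j : A.Index)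

/-- The body of the intersection of two charts, in the coordinates of the first one. -/
def inter : Set (Fin p → ℝ) := ((A.chart i).symm.trans (A.chart j)).source

theorem isOpen_inter : IsOpen (A.inter i j) :=
  ((A.chart i).symm.trans (A.chart j)).open_source

theorem overlap_eq : A.overlap i j = bodyProj ⁻¹' A.inter i j := rfl

theorem isOpen_overlap : IsOpen (A.overlap i j) :=
  isOpen_preimage_bodyProj (A.isOpen_inter i j)

theorem inter_subset : A.inter i j ⊆ (A.chart i).target := fun x hx => by
  rw [inter, OpenPartialHomeomorph.trans_source] at hx
  exact hx.1

theorem inter_self : A.inter i i = (A.chart i).target := by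
  refine (A.inter_subset i i).antisymm fun x hx => ?_
  rw [inter, OpenPartialHomeomorph.trans_source]
  exact ⟨hx, (A.chart i).map_target hx⟩

theorem overlap_subset_dom : A.overlap i j ⊆ A.dom i := fun _ hz => A.inter_subset i j hz

theorem isMapOn_trans : IsMapOn (A.trans i j) (A.inter i j) (A.inter j i) where
  smooth := A.trans_smooth i j
  parity := A.trans_parity i j
  mapsTo x hx := by
    rw [A.trans_body i j hx, inter, OpenPartialHomeomorph.trans_source]
    rw [inter, OpenPartialHomeomorph.trans_source] at hx
    refine ⟨(A.chart j).map_source hx.2, ?_⟩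
    change (A.chart j).symm (A.chart j ((A.chart i).symm x)) ∈ (A.chart i).source
    rw [(A.chart j).left_inv hx.2]
    exact (A.chart i).map_target hx.1

theorem pull_trans_trans (c : Fin p ⊕ Fin q) :
    Set.EqOn (pull (A.trans j i c) (A.trans i j)) (coord c) (A.inter i j) := fun x hx => by
  have hx' := A.inter_subset i j hx
  rw [A.trans_comp i j i c ⟨hx, (A.inter_self i).superset hx'⟩, A.trans_self i c hx']

/-- The coefficients `∂xᵃ/∂x'ᵇ` of the transitions of `ΠT*M`, as functions on the base. -/
noncomputable def invJac (b a : Fin p ⊕ Fin q) : SFun (Fin p) (Fin q) :=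
  pull (pd b (A.trans j i a)) (A.trans i j)

theorem contDiffOn_invJac (b a : Fin p ⊕ Fin q) :
    ContDiffOn ℝ ∞ (A.invJac i j b a) (A.inter i j) :=
  (A.isMapOn_trans i j).contDiffOn_pull (A.isOpen_inter i j) (A.isOpen_inter j i)
    (contDiffOn_pd (A.isOpen_inter j i) ((A.isMapOn_trans j i).smooth a) b)

theorem hasParityOn_invJac (b a : Fin p ⊕ Fin q) :
    HasParityOn (coordParity a + coordParity b) (A.invJac i j b a) (A.inter i j) :=
  (A.isMapOn_trans i j).hasParityOn_pull (A.isOpen_inter i j) (A.isOpen_inter j i)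
    (contDiffOn_pd (A.isOpen_inter j i) ((A.isMapOn_trans j i).smooth a) b)
    (hasParityOn_pd (A.isOpen_inter j i) ((A.isMapOn_trans j i).smooth a)
      ((A.isMapOn_trans j i).parity a) b)

theorem contDiffOn_jac (a b : Fin p ⊕ Fin q) :
    ContDiffOn ℝ ∞ (pd a (A.trans i j b)) (A.inter i j) :=
  contDiffOn_pd (A.isOpen_inter i j) ((A.isMapOn_trans i j).smooth b) a

theorem hasParityOn_jac (a b : Fin p ⊕ Fin q) :
    HasParityOn (coordParity b + coordParity a) (pd a (A.trans i j b)) (A.inter i j) :=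
  hasParityOn_pd (A.isOpen_inter i j) ((A.isMapOn_trans i j).smooth b)
    ((A.isMapOn_trans i j).parity b) a

/-- Differentiate the identity saying that the two transitions compose to the identity in the `j`-th
chart, then pull the result back to the `i`-th chart, where the double pull-back of the Jacobian
collapses. -/
theorem sum_invJac_mul_jac (c b : Fin p ⊕ Fin q) {x : Fin p → ℝ} (hx : x ∈ A.inter i j) :
    ∑ a, A.invJac i j c a x * pd a (A.trans i j b) x = if c = b then 1 else 0 := by
  have hij := A.isMapOn_trans i j
  have hji := A.isMapOn_trans j i
  have oij := A.isOpen_inter i j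
  have oji := A.isOpen_inter j i
  have hbx := hij.mapsTo hx
  have hs := fun a => contDiffOn_pd oji (hji.smooth a) c
  have hF := fun a => hji.contDiffOn_pull oji oij (A.contDiffOn_jac i j a b)
  have hone : Set.EqOn (∑ a, pd c (A.trans j i a) * pull (pd a (A.trans i j b)) (A.trans j i))
      ((if c = b then (1 : ℝ) else 0) • (1 : SFun (Fin p) (Fin q))) (A.inter j i) := by
    intro y hy
    have h1 := hji.pd_pull oji oij (hij.smooth b) hy c
    rw [pd_congr oji (A.pull_trans_trans j i b) c hy, pd_coord] at h1
    rw [Finset.sum_apply, Pi.smul_apply]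
    refine h1.symm.trans ?_
    split_ifs
    · exact (one_smul _ _).symm
    · exact (zero_smul _ _).symm
  have h2 := pull_congr oji (contDiffOn_sum Finset.univ fun a _ => contDiffOn_mul oji (hs a) (hF a))
    hone hbx
  rw [pull_sum oji _ (fun a _ => contDiffOn_mul oji (hs a) (hF a)) hbx,
    pull_smul oji contDiffOn_one _ hbx, hij.pull_one oij oji hx] at h2
  have h3 : ∀ a, pull (pd c (A.trans j i a) * pull (pd a (A.trans i j b)) (A.trans j i))
      (A.trans i j) x = A.invJac i j c a x * pd a (A.trans i j b) x := by
    intro a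
    rw [hij.pull_mul oij oji (hs a) (hF a) hx,
      hij.pull_pull hji oij oji oij (A.contDiffOn_jac i j a b) hx,
      pull_congr_right _ fun d => A.pull_trans_trans i j d hx,
      pull_coord_right oij (A.contDiffOn_jac i j a b) hx]
    rfl
  rw [← Finset.sum_congr rfl fun a _ => h3 a, h2]
  split_ifs
  · exact one_smul _ _
  · exact zero_smul _ _

theorem sum_lift_invJac_mul_lift_jac (c b : Fin p ⊕ Fin q) {z : Fin p ⊕ Fin q → ℝ}
    (hz : z ∈ A.overlap i j) (u : Grassmann (Fin q ⊕ₗ Fin p)) :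
    (∑ a, lift (A.invJac i j c a) z * lift (pd a (A.trans i j b)) z) * u =
      if c = b then u else 0 := by
  have hS := A.isOpen_inter i j
  have hO := A.isOpen_overlap i j
  have hπ := isMapOn_baseProj (q := q) (A.inter i j)
  have hG := A.contDiffOn_invJac i j c
  have hF := fun a => A.contDiffOn_jac i j a b
  have hbz := hπ.mapsTo hz
  have hone : Set.EqOn (∑ a, A.invJac i j c a * pd a (A.trans i j b))
      ((if c = b then (1 : ℝ) else 0) • (1 : SFun (Fin p) (Fin q))) (A.inter i j) := by
    intro y hy
    rw [Finset.sum_apply, Pi.smul_apply]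
    refine (A.sum_invJac_mul_jac i j c b hy).trans ?_
    split_ifs
    · exact (one_smul _ _).symm
    · exact (zero_smul _ _).symm
  have h2 := pull_congr hS
    (contDiffOn_sum Finset.univ fun a _ => contDiffOn_mul hS (hG a) (hF a)) hone hbz
  rw [pull_sum hS _ (fun a _ => contDiffOn_mul hS (hG a) (hF a)) hbz,
    pull_smul hS contDiffOn_one _ hbz, hπ.pull_one hO hS hz] at h2
  rw [Finset.sum_congr rfl fun a _ => hπ.pull_mul hO hS (hG a) (hF a) hz] at h2
  refine (congrArg (· * u) h2).trans ?_
  split_ifs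
  · rw [one_smul, one_mul]
  · rw [zero_smul, zero_mul]

theorem cotangentTrans_baseIdx (b : Fin p ⊕ Fin q) :
    A.cotangentTrans i j (baseIdx b) = lift (A.trans i j b) := tuple_baseIdx _ _ b

theorem cotangentTrans_fibIdx (b : Fin p ⊕ Fin q) :
    A.cotangentTrans i j (fibIdx b) = ∑ a, lift (A.invJac i j b a) * coord (fibIdx a) :=
  tuple_fibIdx _ _ b

theorem tangentTrans_baseIdx (b : Fin p ⊕ Fin q) :
    A.tangentTrans i j (baseIdx b) = lift (A.trans i j b) := tuple_baseIdx _ _ b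

theorem tangentTrans_fibIdx (b : Fin p ⊕ Fin q) :
    A.tangentTrans i j (fibIdx b) = ∑ a, coord (fibIdx a) * lift (pd a (A.trans i j b)) :=
  tuple_fibIdx _ _ b

theorem bodyProj_bodyMap {T : TTuple p q} (hT : ∀ b, T (baseIdx b) = lift (A.trans i j b))
    {z : Fin p ⊕ Fin q → ℝ} (hz : z ∈ A.overlap i j) :
    bodyProj (bodyMap T z) = bodyMap (A.trans i j) (bodyProj z) := by
  funext k
  have h := lift_apply_empty (A.isOpen_inter i j) ((A.isMapOn_trans i j).smooth (.inl k)) hz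
  rw [← hT] at h
  exact h

theorem isMapOn_of_lift {T : TTuple p q} (hT : ∀ b, T (baseIdx b) = lift (A.trans i j b))
    (hs : ∀ b, ContDiffOn ℝ ∞ (T (fibIdx b)) (A.overlap i j))
    (hp : ∀ b, HasParityOn (coordParity (fibIdx b)) (T (fibIdx b)) (A.overlap i j)) :
    IsMapOn T (A.overlap i j) (A.overlap j i) where
  smooth c := by
    rcases eq_baseIdx_or_fibIdx c with ⟨a, rfl⟩ | ⟨a, rfl⟩
    · rw [hT]
      exact contDiffOn_lift (A.isOpen_inter i j) ((A.isMapOn_trans i j).smooth a)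
    · exact hs a
  parity c := by
    rcases eq_baseIdx_or_fibIdx c with ⟨a, rfl⟩ | ⟨a, rfl⟩
    · rw [hT, coordParity_baseIdx]
      exact hasParityOn_lift (A.isOpen_inter i j) ((A.isMapOn_trans i j).smooth a)
        ((A.isMapOn_trans i j).parity a)
    · exact hp a
  mapsTo z hz := by
    change bodyProj (bodyMap T z) ∈ A.inter j i
    rw [A.bodyProj_bodyMap i j hT hz]
    exact (A.isMapOn_trans i j).mapsTo hz

theorem isMapOn_cotangentTrans :
    IsMapOn (A.cotangentTrans i j) (A.overlap i j) (A.overlap j i) := by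
  have hS := A.isOpen_inter i j
  refine A.isMapOn_of_lift i j (A.cotangentTrans_baseIdx i j) (fun b => ?_) fun b z hz => ?_
  · rw [cotangentTrans_fibIdx]
    exact contDiffOn_sum _ fun a _ => contDiffOn_mul (A.isOpen_overlap i j)
      (contDiffOn_lift hS (A.contDiffOn_invJac i j b a)) (contDiffOn_coord _ _)
  · rw [cotangentTrans_fibIdx, Finset.sum_apply]
    refine HasParity.sum fun a _ => ?_
    have := (hasParityOn_lift hS (A.contDiffOn_invJac i j b a) (A.hasParityOn_invJac i j b a) z
      hz).mul (hasParity_coord (fibIdx a) z)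
    rw [coordParity_fibIdx] at this ⊢
    rw [show coordParity b + 1 = coordParity a + coordParity b + (coordParity a + 1) from by
      generalize coordParity a = s
      generalize coordParity b = t
      revert s t; decide]
    exact this

theorem isMapOn_tangentTrans :
    IsMapOn (A.tangentTrans i j) (A.overlap i j) (A.overlap j i) := by
  have hS := A.isOpen_inter i j
  refine A.isMapOn_of_lift i j (A.tangentTrans_baseIdx i j) (fun b => ?_) fun b z hz => ?_
  · rw [tangentTrans_fibIdx]
    exact contDiffOn_sum _ fun a _ => contDiffOn_mul (A.isOpen_overlap i j)
      (contDiffOn_coord _ _) (contDiffOn_lift hS (A.contDiffOn_jac i j a b))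
  · rw [tangentTrans_fibIdx, Finset.sum_apply]
    refine HasParity.sum fun a _ => ?_
    have := (hasParity_coord (fibIdx a) z).mul (hasParityOn_lift hS (A.contDiffOn_jac i j a b)
      (A.hasParityOn_jac i j a b) z hz)
    rw [coordParity_fibIdx] at this ⊢
    rw [show coordParity b + 1 = coordParity a + 1 + (coordParity b + coordParity a) from by
      generalize coordParity a = s
      generalize coordParity b = t
      revert s t; decide]
    exact this

variable {A} {P : A.Index → TFun p q}

/-- The new base coordinates do not involve `x*ₐ`, and the new fibre coordinates are linear in it.
The coefficient stands to the left of `x*ₐ`, so the derivative passes it and twists it. -/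
theorem IsEvenMultivector.pd_fibIdx (hP : A.IsEvenMultivector P) {x : Fin p ⊕ Fin q → ℝ}
    (hx : x ∈ A.overlap i j) (a : Fin p ⊕ Fin q) :
    pd (fibIdx a) (P i) x = ∑ b, twist (coordParity (fibIdx a)) (lift (A.invJac i j b a) x) *
      pull (pd (fibIdx b) (P j)) (A.cotangentTrans i j) x := by
  have hO := A.isOpen_overlap i j
  have hS := A.isOpen_inter i j
  have hT := A.isMapOn_cotangentTrans i j
  have hPj := (hP.smooth j).mono (A.overlap_subset_dom j i)
  have hPij : Set.EqOn (P i) (pull (P j) (A.cotangentTrans i j)) (A.overlap i j) := fun y hy =>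
    hP.compat i j ⟨A.overlap_subset_dom i j hy, hy⟩
  rw [pd_congr hO hPij _ hx, hT.pd_pull hO (A.isOpen_overlap j i) hPj hx, sum_tIdx,
    Finset.sum_eq_zero, zero_add]
  · refine Finset.sum_congr rfl fun b _ => ?_
    have hl := fun c => contDiffOn_lift (q := q) hS (A.contDiffOn_invJac i j b c)
    congr 1
    rw [cotangentTrans_fibIdx, pd_sum _ fun c _ => differentiableAt_of_contDiffOn hO
      (contDiffOn_mul hO (hl c) (contDiffOn_coord _ _)) hx, Finset.sum_eq_single a]
    · rw [pd_mul (differentiableAt_of_contDiffOn hO (hl a) hx)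
        (differentiableAt_of_contDiffOn hO (contDiffOn_coord _ _) hx), pd_coord_self,
        pd_fibIdx_lift hS (A.contDiffOn_invJac i j b a) hx, zero_mul, zero_add, mul_one]
    · intro c _ hc
      rw [pd_mul (differentiableAt_of_contDiffOn hO (hl c) hx)
        (differentiableAt_of_contDiffOn hO (contDiffOn_coord _ _) hx),
        pd_coord_of_ne fun h => hc (fibIdx_injective h).symm,
        pd_fibIdx_lift hS (A.contDiffOn_invJac i j b c) hx, zero_mul, zero_add, mul_zero]
    · exact fun h => (h (Finset.mem_univ a)).elim
  · intro b _
    rw [cotangentTrans_baseIdx, pd_fibIdx_lift hS ((A.isMapOn_trans i j).smooth b) hx, zero_mul]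

/-- The field `x*ₐ ∂/∂x*ₐ` is the Euler field of the fibres and is unaffected by a linear change of
fibre coordinates; moving `x*ₐ` across the coefficients creates the same twist as differentiating
past them. -/
theorem IsEvenMultivector.eulerSub_compat (hP : A.IsEvenMultivector P) :
    Set.EqOn (eulerSub (P i)) (pull (eulerSub (P j)) (A.cotangentTrans i j)) (A.overlap i j) := by
  intro x hx
  have hO := A.isOpen_overlap i j
  have hO' := A.isOpen_overlap j i
  have hT := A.isMapOn_cotangentTrans i j
  have hPj := (hP.smooth j).mono (A.overlap_subset_dom j i)
  have hxb := hT.mapsTo hx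
  have hm : ∀ a, ContDiffOn ℝ ∞ (coord (fibIdx a) * pd (fibIdx a) (P j)) (A.overlap j i) :=
    fun a => contDiffOn_mul hO' (contDiffOn_coord _ _) (contDiffOn_pd hO' hPj _)
  rw [eulerSub, eulerSub, sub_eq_add_neg (∑ a, coord (fibIdx a) * pd (fibIdx a) (P j)),
    pull_add hO' (contDiffOn_sum _ fun a _ => hm a) (contDiffOn_neg hPj) hxb,
    pull_sum hO' _ (fun a _ => hm a) hxb, pull_neg hO' hPj hxb, Pi.sub_apply, Finset.sum_apply,
    hP.compat i j ⟨A.overlap_subset_dom i j hx, hx⟩, sub_eq_add_neg]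
  congr 1
  have h1 : ∀ b, pull (coord (fibIdx b) * pd (fibIdx b) (P j)) (A.cotangentTrans i j) x =
      ∑ a, coord (fibIdx a) x * (twist (coordParity (fibIdx a)) (lift (A.invJac i j b a) x) *
        pull (pd (fibIdx b) (P j)) (A.cotangentTrans i j) x) := by
    intro b
    rw [hT.pull_mul hO hO' (contDiffOn_coord _ _) (contDiffOn_pd hO' hPj _) hx,
      hT.pull_coord hO hO' hx, cotangentTrans_fibIdx, Finset.sum_apply, Finset.sum_mul]
    refine Finset.sum_congr rfl fun a _ => ?_
    rw [Pi.mul_apply, (hasParity_coord (fibIdx a) x).mul_eq_mul_twist, mul_assoc]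
  simp only [h1]
  rw [Finset.sum_comm]
  refine Finset.sum_congr rfl fun a _ => ?_
  rw [Pi.mul_apply, hP.pd_fibIdx i j hx, Finset.mul_sum]

/-- `φ_P` is independent of the chart: fibre derivatives of `P` transform by the inverse of the
matrix acting on `x*`, which is the matrix acting on `dx`. The sign `(-1) ^ (ã + 1)` absorbs the
Koszul signs of reordering the factors. -/
theorem IsEvenMultivector.phi_compat (hP : A.IsEvenMultivector P)
    {W V : Set (Fin p ⊕ Fin q → ℝ)} (hW : IsOpen W) (hWO : W ⊆ A.overlap i j)
    (hφ : IsMapOn (phi (P i)) W V) (hV : V ⊆ A.overlap i j) (c : TIdx p q) :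
    Set.EqOn (pull (phi (P j) c) (A.cotangentTrans i j))
      (pull (A.tangentTrans i j c) (phi (P i))) W := by
  intro x hxW
  have hx := hWO hxW
  have hO := A.isOpen_overlap i j
  have hO' := A.isOpen_overlap j i
  have hS := A.isOpen_inter i j
  have hT := A.isMapOn_cotangentTrans i j
  have hPj := (hP.smooth j).mono (A.overlap_subset_dom j i)
  have hφ' : IsMapOn (phi (P i)) W (A.overlap i j) :=
    hφ.mono le_rfl fun y hy => hV (hφ.mapsTo hy)
  have hpl : ∀ {f : SFun (Fin p) (Fin q)}, ContDiffOn ℝ ∞ f (A.inter i j) →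
      pull (lift f) (phi (P i)) x = lift f x := by
    intro f hf
    rw [pull_lift hW hS hφ' hf hxW]
    exact pull_congr_right f fun a => congrFun (phi_baseIdx (P i) a) x
  rcases eq_baseIdx_or_fibIdx c with ⟨b, rfl⟩ | ⟨b, rfl⟩
  · rw [phi_baseIdx, hT.pull_coord hO hO' hx, cotangentTrans_baseIdx, tangentTrans_baseIdx,
      hpl ((A.isMapOn_trans i j).smooth b)]
  · have hl := fun a => contDiffOn_lift (q := q) hS (A.contDiffOn_jac i j a b)
    rw [tangentTrans_fibIdx, pull_sum hO _
      (fun a _ => contDiffOn_mul hO (contDiffOn_coord _ _) (hl a)) (hφ'.mapsTo hxW)]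
    have h1 : ∀ a, pull (coord (fibIdx a) * lift (pd a (A.trans i j b))) (phi (P i)) x =
        ∑ c, parSign (coordParity (fibIdx b) * coordParity (fibIdx c)) •
          (lift (A.invJac i j c a) x * lift (pd a (A.trans i j b)) x *
            pull (pd (fibIdx c) (P j)) (A.cotangentTrans i j) x) := by
      intro a
      rw [hφ'.pull_mul hW hO (contDiffOn_coord _ _) (hl a) hxW, hφ'.pull_coord hW hO hxW,
        hpl (A.contDiffOn_jac i j a b), phi_fibIdx, Pi.smul_apply, ← parSign_fibIdx,
        hP.pd_fibIdx i j hx, Finset.smul_sum, Finset.sum_mul]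
      refine Finset.sum_congr rfl fun c _ => ?_
      have hG := hasParityOn_lift hS (A.contDiffOn_invJac i j c a) (A.hasParityOn_invJac i j c a)
        x hx
      have hF := hasParityOn_lift hS (A.contDiffOn_jac i j a b) (A.hasParityOn_jac i j a b) x hx
      have hπ := hT.hasParityOn_pull hO hO' (contDiffOn_pd hO' hPj (fibIdx c))
        (hasParityOn_pd hO' hPj (fun y hy => hP.parity j y (A.overlap_subset_dom j i hy))
          (fibIdx c)) x hx
      -- The sign of `phi`, the twist of the inverse Jacobian and the swap with the Jacobian combine
      -- into one sign that no longer depends on the summation index `a`, so the two Jacobians can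
      -- be contracted.
      rw [hG.twist_eq, smul_mul_assoc, smul_mul_assoc, smul_mul_assoc, mul_assoc,
        hπ.mul_swap hF, mul_smul_comm, smul_smul, smul_smul, ← parSign_add, ← parSign_add,
        ← mul_assoc]
      congr 2
      rw [coordParity_fibIdx, coordParity_fibIdx, coordParity_fibIdx]
      generalize coordParity a = s
      generalize coordParity b = t
      generalize coordParity c = r
      revert s t r; decide
    simp only [h1]
    rw [Finset.sum_comm]
    simp only [← Finset.smul_sum, ← Finset.sum_mul, A.sum_lift_invJac_mul_lift_jac i j _ b hx _]
    rw [Finset.sum_eq_single b, if_pos rfl, phi_fibIdx,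
      pull_smul hO' (contDiffOn_pd hO' hPj _) _ (hT.mapsTo hx), ← parSign_fibIdx]
    · congr 2
      generalize coordParity (fibIdx b) = s
      revert s; decide
    · intro c _ hc
      rw [if_neg hc, smul_zero]
    · exact fun h => (h (Finset.mem_univ b)).elim

/-- Since the maps `φ_P` intertwine the transitions, so do their inverses; the invariant function
`x*ₐ ∂P/∂x*ₐ - P` is then carried to compatible local forms. -/
theorem legendre_compat (hP : A.IsEvenMultivector P)
    {W V : A.Index → Set (Fin p ⊕ Fin q → ℝ)}
    (hW : A.IsOpenSub A.cotangentTrans W) (hV : A.IsOpenSub A.tangentTrans V)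
    {ψ : A.Index → TTuple p q} (hψ : A.IsInversePhi P W V ψ) :
    Set.EqOn (A.legendre P ψ i) (pull (A.legendre P ψ j) (A.tangentTrans i j))
      (V i ∩ A.overlap i j) := by
  have hO := A.isOpen_overlap i j
  have oW := hW.isOpen j
  have oV := hV.isOpen j
  have hWi : IsOpen (W i ∩ A.overlap i j) := (hW.isOpen i).inter hO
  have hVi : IsOpen (V i ∩ A.overlap i j) := (hV.isOpen i).inter hO
  -- Both `φ_P` and `ψ` cover the identity of the base, hence restrict to the parts of `W i` and `V
  -- i` over the intersection of the charts.
  have hφbase : ∀ y, bodyProj (bodyMap (phi (P i)) y) = bodyProj y := fun y => by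
    funext k
    have : phi (P i) (.inl (.inl k)) = coord (.inl (.inl k)) := phi_baseIdx (P i) (.inl k)
    exact (congrArg (fun f : TFun p q => (f y).body) this).trans
      (congrFun (bodyMap_coord (β := Fin q ⊕ₗ Fin p) y) (.inl k))
  have hψbase : ∀ z ∈ V i, bodyProj (bodyMap (ψ i) z) = bodyProj z := fun z hz => by
    rw [← hφbase, ← (hψ i).inv.bodyMap_comp (hψ i).map (hW.isOpen i) hz]
    congr 1
    rw [← bodyMap_coord (β := Fin q ⊕ₗ Fin p) z]
    funext a
    rw [bodyMap, (hψ i).right_inv _ (by rwa [bodyMap_coord]), bodyMap_coord]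
    exact congrFun (bodyMap_coord (β := Fin q ⊕ₗ Fin p) z) a
  have hφ : IsMapOn (phi (P i)) (W i ∩ A.overlap i j) (V i ∩ A.overlap i j) :=
    (hψ i).map.mono Set.inter_subset_left fun y hy => ⟨(hψ i).map.mapsTo hy.1, by
      rw [overlap_eq, Set.mem_preimage, hφbase]; exact hy.2⟩
  have hψi : IsMapOn (ψ i) (V i ∩ A.overlap i j) (W i ∩ A.overlap i j) :=
    (hψ i).inv.mono Set.inter_subset_left fun z hz => ⟨(hψ i).inv.mapsTo hz.1, by
      rw [overlap_eq, Set.mem_preimage, hψbase z hz.1]; exact hz.2⟩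
  have hT : IsMapOn (A.tangentTrans i j) (V i ∩ A.overlap i j) (V j) :=
    (A.isMapOn_tangentTrans i j).mono Set.inter_subset_right fun z hz =>
      (hV.compat i j z hz.2).1 hz.1
  have hT' : IsMapOn (A.cotangentTrans i j) (W i ∩ A.overlap i j) (W j) :=
    (A.isMapOn_cotangentTrans i j).mono Set.inter_subset_right fun z hz =>
      (hW.compat i j z hz.2).1 hz.1
  have hEj := contDiffOn_eulerSub oW ((hP.smooth j).mono (hW.subset j))
  have hEi := contDiffOn_eulerSub hWi ((hP.smooth i).mono fun y hy => hW.subset i hy.1)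
  -- Applying `ψ j` to the intertwining relation expresses the cotangent transition as `ψ j`, after
  -- the tangent transition, after `φ_P`; composing with `ψ i` on the right then gives the relation
  -- for the inverses.
  have hcT : ∀ c, Set.EqOn (A.cotangentTrans i j c)
      (pull (pull (ψ j c) (A.tangentTrans i j)) (phi (P i))) (W i ∩ A.overlap i j) := by
    intro c x hx
    rw [hφ.pull_pull hT hWi hVi oV ((hψ j).inv.smooth c) hx,
      ← pull_congr_right (ψ j c) fun d => hP.phi_compat i j hWi Set.inter_subset_right hφ
        Set.inter_subset_right d hx,
      ← hT'.pull_pull (hψ j).map hWi oW oV ((hψ j).inv.smooth c) hx,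
      pull_congr oW ((hψ j).map.contDiffOn_pull oW oV ((hψ j).inv.smooth c)) ((hψ j).left_inv c)
        (hT'.mapsTo hx), hT'.pull_coord hWi oW hx]
  have hcomp : ∀ c, Set.EqOn (pull (A.cotangentTrans i j c) (ψ i))
      (pull (ψ j c) (A.tangentTrans i j)) (V i ∩ A.overlap i j) := by
    intro c z hz
    have hs := hT.contDiffOn_pull hVi oV ((hψ j).inv.smooth c)
    rw [pull_congr hWi (hT'.smooth c) (hcT c) (hψi.mapsTo hz),
      hψi.pull_pull hφ hVi hWi hVi hs hz, pull_congr_right _ fun d => (hψ i).right_inv d hz.1,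
      pull_coord_right hVi hs hz]
  intro z hz
  have hcE : Set.EqOn (eulerSub (P i)) (pull (eulerSub (P j)) (A.cotangentTrans i j))
      (W i ∩ A.overlap i j) := fun y hy => hP.eulerSub_compat i j hy.2
  rw [legendre, legendre, pull_congr hWi hEi hcE (hψi.mapsTo hz),
    hψi.pull_pull hT' hVi hWi oW hEj hz, pull_congr_right _ fun c => hcomp c hz,
    ← hT.pull_pull (hψ j).inv hVi oV oW hEj hz]

end SuperAtlas

end Superdomains

/-! ### The global theorem -/

theorem theorem2 {p q : ℕ} {M : Type*} [TopologicalSpace M] (A : SuperAtlas p q M)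
    (P : A.Index → TFun p q) (hP : A.IsEvenMultivector P)
    (W V : A.Index → Set (Fin p ⊕ Fin q → ℝ))
    (hW : A.IsOpenSub A.cotangentTrans W) (hV : A.IsOpenSub A.tangentTrans V)
    (ψ : A.Index → TTuple p q) (hψ : A.IsInversePhi P W V ψ) :
    A.IsFunction A.tangentTrans V 0 (A.legendre P ψ) ∧
    (∀ i, Set.EqOn (extDiff (A.legendre P ψ i))
      (-(1 / 2 : ℝ) • pull (schouten (P i) (P i)) (ψ i)) (V i)) ∧
    ((∀ i, Set.EqOn (schouten (P i) (P i)) 0 (W i)) ↔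
      ∀ i, Set.EqOn (extDiff (A.legendre P ψ i)) 0 (V i)) := by
  have hs := fun i => (hP.smooth i).mono (hW.subset i)
  have h0 : ∀ i, HasParityOn 0 (P i) (W i) := fun i x hx => hP.parity i x (hW.subset i hx)
  refine ⟨⟨fun i => ?_, fun i => ?_, fun i j => SuperAtlas.legendre_compat i j hP hW hV hψ⟩,
    fun i => extDiff_pull_eulerSub (hW.isOpen i) (hV.isOpen i) (hs i) (h0 i) (hψ i),
    forall_congr' fun i =>
      schouten_eq_zero_iff (hW.isOpen i) (hV.isOpen i) (hs i) (h0 i) (hψ i)⟩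
  · exact (hψ i).inv.contDiffOn_pull (hV.isOpen i) (hW.isOpen i)
      (contDiffOn_eulerSub (hW.isOpen i) (hs i))
  · exact (hψ i).inv.hasParityOn_pull (hV.isOpen i) (hW.isOpen i)
      (contDiffOn_eulerSub (hW.isOpen i) (hs i)) (hasParityOn_eulerSub (hW.isOpen i) (hs i) (h0 i))
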